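/- Let $A$ be a generalized Cartan matrix of hyperbolic type, i.e. $A$ is indecomposable, symmetrizable, of indefinite type, and every proper principal submatrix of the corresponding symmetric matrix $B=DA$ ($D$ a positive diagonal matrix) is a direct sum of matrices of finite or affine type. Let $\alpha_1,\dots,\alpha_{n+1}$ be its simple roots, $L=\bigoplus_i\mathbb Z\alpha_i$ its root lattice with the invariant form $(\alpha_i|\alpha_j)=B_{ij}$, $W$ its Weyl group, and $\Delta=\Delta^{re}\cup\Delta^{im}$ its root system, where $\Delta^{re}=\bigcup_i W\alpha_i$ and $\Delta^{im}=\{\alpha\in L\setminus\{0\} : (\alpha|\alpha)\le 0\}$. Let $\Delta_1\subset\Delta$ be the root system of a generalized Cartan matrix $A_1$ of hyperbolic type whose root lattice $L_1\subset L$ has the same rank as $L$ and whose invariant form is, up to a positive factor, the restriction of $(\cdot|\cdot)$ to $L_1$; write $\Delta_1^{re}$ for its real roots and let $W_1$ be its Weyl group, i.e. the group of automorphisms of $L$ generated by the reflections in the simple roots of $\Delta_1$. Let $F$ and $F_1$ be fundamental chambers of $W$ and $W_1$, and suppose that the decomposition $(F,F_1)$ of $F_1$ into copies of $F$ is minimal,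 i.e. that $W_1$ is a maximal proper reflection subgroup of $W$: $W_1\subsetneq W$, and no subgroup of $W$ generated by reflections lies strictly between $W_1$ and $W$. Then the following four conditions are equivalent: (i) $L_1$ is a proper sublattice of $L$, i.e. $L_1\neq L$; (ii) $\Delta_1=\Delta\cap L_1$; (iii) $\Delta_1$ is a root subsystem of $\Delta$, i.e. if $\alpha,\beta\in\Delta_1$ and $\alpha+\beta\in\Delta$, then $\alpha+\beta\in\Delta_1$; (iv) if $\alpha,\beta\in\Delta_1^{re}$ and $\alpha+\beta\in\Delta^{re}$, then $\alpha+\beta\in\Delta_1^{re}$. -/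

import Mathlib

/-! Root lattices are written in coordinates with respect to the simple roots: for a generalized
Cartan matrix `A` indexed by `ι`, the root lattice is `ι → ℤ` and the simple root `α_i` is
`Pi.single i 1`. -/

namespace HypRoot

variable {ι κ : Type*} [Fintype ι] [DecidableEq ι] [Fintype κ] [DecidableEq κ]

/-- Generalized Cartan matrix. -/
structure IsGCM (A : Matrix ι ι ℤ) : Prop where
  diag : ∀ i, A i i = 2
  offDiag : ∀ i j, i ≠ j → A i j ≤ 0
  zero : ∀ i j, A i j = 0 → A j i = 0

/-- The principal submatrix of `A` on `S` is indecomposable: `S` does not split into two nonempty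
parts without links between them. -/
def IndecomposableOn (A : Matrix ι ι ℤ) (S : Finset ι) : Prop :=
  ∀ T ⊆ S, T.Nonempty → T ≠ S → ∃ i ∈ T, ∃ j ∈ S \ T, A i j ≠ 0 ∨ A j i ≠ 0

/-- `d` is the diagonal of a positive diagonal matrix `D` such that `D A` is symmetric. -/
structure IsSymmetrizer (A : Matrix ι ι ℤ) (d : ι → ℝ) : Prop where
  pos : ∀ i, 0 < d i
  symm : ∀ i j, d i * (A i j : ℝ) = d j * (A j i : ℝ)

/-- The symmetric matrix `B = D A` corresponding to `A`. -/
def symMatrix (A : Matrix ι ι ℤ) (d : ι → ℝ) : Matrix ι ι ℝ :=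
  Matrix.of fun i j => d i * (A i j : ℝ)

/-- The principal submatrix of `B` on `S`. -/
def principal (B : Matrix ι ι ℝ) (S : Finset ι) : Matrix S S ℝ :=
  B.submatrix Subtype.val Subtype.val

/-- Finite type, for the symmetric matrix of an indecomposable generalized Cartan matrix. -/
def IsFiniteType (B : Matrix κ κ ℝ) : Prop := B.PosDef

/-- Affine type, for the symmetric matrix of an indecomposable generalized Cartan matrix. -/
def IsAffineType (B : Matrix κ κ ℝ) : Prop :=
  B.PosSemidef ∧ B.rank + 1 = Fintype.card κ

/-- Indefinite type, for the symmetric matrix of an indecomposable generalized Cartan matrix. -/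
def IsIndefiniteType (B : Matrix κ κ ℝ) : Prop :=
  ¬ IsFiniteType B ∧ ¬ IsAffineType B

/-- `A` is a generalized Cartan matrix of hyperbolic type, with symmetrizer `d`: it is
indecomposable, symmetrizable, of indefinite type, and every proper principal submatrix of the
corresponding symmetric matrix is (a direct sum of matrices) of finite or affine type. -/
structure IsHyperbolic (A : Matrix ι ι ℤ) (d : ι → ℝ) : Prop where
  gcm : IsGCM A
  indecomposable : IndecomposableOn A Finset.univ
  symmetrizer : IsSymmetrizer A d
  indefinite : IsIndefiniteType (symMatrix A d)
  proper_sub : ∀ S : Finset ι, S ≠ Finset.univ → IndecomposableOn A S →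
    IsFiniteType (principal (symMatrix A d) S) ∨ IsAffineType (principal (symMatrix A d) S)

/-- The invariant form `(x | y)` on the root lattice; `(α_i | α_j) = d_i A_ij`. -/
noncomputable def form (A : Matrix ι ι ℤ) (d : ι → ℝ) (x y : ι → ℤ) : ℝ :=
  ∑ i, ∑ j, (x i : ℝ) * symMatrix A d i j * (y j : ℝ)

/-- The simple root `α_i`. -/
def simpleRoot (i : ι) : ι → ℤ := Pi.single i 1

/-- The Weyl group of `A`, acting on the root lattice: it is generated by the simple reflections
`x ↦ x - ⟨x, α_i^∨⟩ α_i`, where `⟨α_j, α_i^∨⟩ = A_ij`. -/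
def weylGroup (A : Matrix ι ι ℤ) : Subgroup ((ι → ℤ) ≃ₗ[ℤ] (ι → ℤ)) :=
  Subgroup.closure {w | ∃ i, ∀ x, w x = x - (∑ j, A i j * x j) • simpleRoot i}

/-- Real roots. -/
def realRoots (A : Matrix ι ι ℤ) : Set (ι → ℤ) :=
  {x | ∃ w ∈ weylGroup A, ∃ i, x = w (simpleRoot i)}

/-- Imaginary roots of a hyperbolic root system. -/
def imagRoots (A : Matrix ι ι ℤ) (d : ι → ℝ) : Set (ι → ℤ) :=
  {x | x ≠ 0 ∧ form A d x x ≤ 0}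

/-- The hyperbolic root system `Δ(A)`. -/
def roots (A : Matrix ι ι ℤ) (d : ι → ℝ) : Set (ι → ℤ) :=
  realRoots A ∪ imagRoots A d

/-- `w` is the orthogonal reflection of the root lattice in the mirror orthogonal to the lattice
vector `v` of positive square, i.e. a reflection of the hyperbolic space. -/
def IsReflectionIn (A : Matrix ι ι ℤ) (d : ι → ℝ) (v : ι → ℤ)
    (w : (ι → ℤ) ≃ₗ[ℤ] (ι → ℤ)) : Prop :=
  0 < form A d v v ∧
    ∀ x i, ((w x i : ℤ) : ℝ) = (x i : ℝ) - 2 * form A d x v / form A d v v * (v i : ℝ)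

/-- The group generated by the reflections in the vectors of `S`. -/
def reflectionGroup (A : Matrix ι ι ℤ) (d : ι → ℝ) (S : Set (ι → ℤ)) :
    Subgroup ((ι → ℤ) ≃ₗ[ℤ] (ι → ℤ)) :=
  Subgroup.closure {w | ∃ v ∈ S, IsReflectionIn A d v w}

/-- `G` is generated by reflections. (A reflection that preserves the lattice has a normal vector
in the lattice.) -/
def IsReflectionGroup (A : Matrix ι ι ℤ) (d : ι → ℝ)
    (G : Subgroup ((ι → ℤ) ≃ₗ[ℤ] (ι → ℤ))) : Prop :=
  ∃ R : Set ((ι → ℤ) ≃ₗ[ℤ] (ι → ℤ)),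
    (∀ w ∈ R, ∃ v, IsReflectionIn A d v w) ∧ G = Subgroup.closure R

/-- `Δ(A₁)`, transported by `φ`, is a hyperbolic root system contained in `Δ(A)` whose root lattice
`L₁ = range φ` is a maximal rank sublattice of the root lattice of `A`; the invariant form of
`Δ(A₁)` is, up to a positive factor, the restriction of the one of `Δ(A)`. -/
structure IsRootSystemIn (A : Matrix ι ι ℤ) (d : ι → ℝ) (A₁ : Matrix κ κ ℤ) (d₁ : κ → ℝ)
    (φ : (κ → ℤ) →ₗ[ℤ] (ι → ℤ)) : Prop where
  injective : Function.Injective φ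
  form_eq : ∃ c : ℝ, 0 < c ∧ ∀ x y, form A d (φ x) (φ y) = c * form A₁ d₁ x y
  subset : φ '' roots A₁ d₁ ⊆ roots A d
  maxRank : Module.finrank ℤ (LinearMap.range φ) = Module.finrank ℤ (ι → ℤ)

/-- The Weyl group of `Δ₁ ⊆ Δ(A)` as a group of automorphisms of the root lattice of `A`: it is
generated by the reflections in the facets of the fundamental chamber `F₁`, i.e. in the simple
roots of `Δ₁`. -/
def subWeylGroup (A : Matrix ι ι ℤ) (d : ι → ℝ) (φ : (κ → ℤ) →ₗ[ℤ] (ι → ℤ)) :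
    Subgroup ((ι → ℤ) ≃ₗ[ℤ] (ι → ℤ)) :=
  reflectionGroup A d (Set.range fun j : κ => φ (simpleRoot j))

/-- The decomposition of the chamber `F₁` of `Δ₁` into copies of the chamber `F` of `Δ(A)` is
minimal: the Weyl group of `Δ₁` is a maximal proper reflection subgroup of the Weyl group of
`Δ(A)`. -/
def IsMinimalDecomposition (A : Matrix ι ι ℤ) (d : ι → ℝ) (φ : (κ → ℤ) →ₗ[ℤ] (ι → ℤ)) : Prop :=
  subWeylGroup A d φ < weylGroup A ∧
    ∀ G, IsReflectionGroup A d G → subWeylGroup A d φ ≤ G → G < weylGroup A →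
      G = subWeylGroup A d φ

/-- The closure condition for `Δ₁ ⊆ Δ`: if `α, β ∈ Δ₁` and `α + β ∈ Δ`, then `α + β ∈ Δ₁`. -/
def ClosedIn {M : Type*} [Add M] (Δ₁ Δ : Set M) : Prop :=
  ∀ α ∈ Δ₁, ∀ β ∈ Δ₁, α + β ∈ Δ → α + β ∈ Δ₁

end HypRoot

/-! Write L₁ for the range of φ. The implications 2 → 3 → 4 are formal: a sublattice is closed under
addition, and a vector of positive square cannot be an imaginary root. The content is in 1 → 2 and 4
→ 1.

1 → 2 (`image_roots_eq`). Let R be the real roots of Δ in L₁. Its reflection group W(R) lies between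
W₁ and W. By `mem_of_reflection_mem`, if a set of real roots is stable under its own reflections,
the group these generate contains no reflection in any other real root. So W(R) = W would put all
simple roots in L₁, against L₁ ≠ L; by maximality W(R) = W₁, and the same lemma, applied to the real
roots of Δ₁, shows that R consists of real roots of Δ₁. Imaginary roots are determined by the form
alone. The lemma is proved with a sign character: over the positive roots α outside R, multiply the
signs of gα. Reflections in R give 1, as their sign changes pair off; a reflection in a root v
outside R leaves only ±v unpaired and gives -1. The product is finite because finitely many mirrors
separate two points of hyperbolic space (`finite_separating`).

4 → 1 (`weylGroup_le`). Suppose L₁ = L, and let X be the set of real roots of Δ that are not real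
roots of Δ₁. Closedness makes X an `IsDescentSet`, and `IsDescentSet.eq_empty` shows by descent on
the size of the coordinates in the simple roots of Δ₁ that X is empty. Then every simple root of Δ
is a real root of Δ₁, so W ≤ W₁, a contradiction. The descent uses hyperbolicity through the sign of
the form: one zero coordinate gives a nonnegative square, and two zero coordinates (for a nonzero
vector) or coordinates of both signs give a positive one. -/

namespace HypRoot

variable {ι κ : Type*} [Fintype ι] [DecidableEq ι] [Fintype κ] [DecidableEq κ]

set_option linter.unusedSectionVars false

/-! ### The invariant form on the real span of the root lattice -/

/-- The real bilinear extension of the invariant form. -/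
noncomputable def realForm (A : Matrix ι ι ℤ) (d : ι → ℝ) : LinearMap.BilinForm ℝ (ι → ℝ) :=
  Matrix.toBilin' (symMatrix A d)

theorem realForm_apply (A : Matrix ι ι ℤ) (d : ι → ℝ) (x y : ι → ℝ) :
    realForm A d x y = ∑ i, ∑ j, x i * symMatrix A d i j * y j :=
  Matrix.toBilin'_apply _ _ _

theorem realForm_single_left (A : Matrix ι ι ℤ) (d : ι → ℝ) (i : ι) (y : ι → ℝ) :
    realForm A d (Pi.single i 1) y = ∑ j, symMatrix A d i j * y j := by
  rw [realForm_apply, Finset.sum_eq_single i]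
  · simp
  · intro k _ hk
    simp [hk]
  · simp

theorem realForm_eq_sum (A : Matrix ι ι ℤ) (d : ι → ℝ) (x y : ι → ℝ) :
    realForm A d x y = ∑ i, x i * realForm A d (Pi.single i 1) y := by
  simp_rw [realForm_single_left, realForm_apply, Finset.mul_sum, mul_assoc]

namespace IsSymmetrizer

variable {A : Matrix ι ι ℤ} {d : ι → ℝ}

theorem symMatrix_comm (h : IsSymmetrizer A d) (i j : ι) :
    symMatrix A d i j = symMatrix A d j i := h.symm i j

theorem realForm_comm (h : IsSymmetrizer A d) (x y : ι → ℝ) :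
    realForm A d x y = realForm A d y x := by
  rw [realForm_apply, realForm_apply, Finset.sum_comm]
  refine Finset.sum_congr rfl fun i _ => Finset.sum_congr rfl fun j _ => ?_
  rw [h.symMatrix_comm j i]
  ring

end IsSymmetrizer

/-! ### Squares of vectors with vanishing or mixed coordinates -/

namespace IsHyperbolic

variable {A : Matrix ι ι ℤ} {d : ι → ℝ}

theorem symMatrix_diag_pos (hA : IsHyperbolic A d) (i : ι) : 0 < symMatrix A d i i := by
  have := hA.symmetrizer.pos i
  simp [symMatrix, hA.gcm.diag i, this]

theorem symMatrix_nonpos (hA : IsHyperbolic A d) {i j : ι} (hij : i ≠ j) :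
    symMatrix A d i j ≤ 0 := by
  have h : (A i j : ℝ) ≤ 0 := by exact_mod_cast hA.gcm.offDiag i j hij
  exact mul_nonpos_of_nonneg_of_nonpos (hA.symmetrizer.pos i).le h

theorem symMatrix_eq_zero_iff (hA : IsHyperbolic A d) {i j : ι} :
    symMatrix A d i j = 0 ↔ A i j = 0 := by
  simp [symMatrix, (hA.symmetrizer.pos i).ne']

theorem realForm_single_single (i j : ι) :
    realForm A d (Pi.single i 1) (Pi.single j 1) = symMatrix A d i j :=
  Matrix.toBilin'_single _ _ _

theorem realForm_comm (hA : IsHyperbolic A d) (x y : ι → ℝ) :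
    realForm A d x y = realForm A d y x := hA.symmetrizer.realForm_comm x y

theorem realForm_add_self (hA : IsHyperbolic A d) (x y : ι → ℝ) :
    realForm A d (x + y) (x + y) =
      realForm A d x x + 2 * realForm A d x y + realForm A d y y := by
  simp only [map_add, LinearMap.add_apply, hA.realForm_comm y x]
  ring

theorem realForm_sub_self (hA : IsHyperbolic A d) (x y : ι → ℝ) :
    realForm A d (x - y) (x - y) =
      realForm A d x x - 2 * realForm A d x y + realForm A d y y := by
  simp only [map_sub, LinearMap.sub_apply, hA.realForm_comm y x]
  ring

/-- A nonempty set of indices without links to its complement is everything. -/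
theorem eq_univ_of_unlinked (hA : IsHyperbolic A d) {T : Finset ι} (hT : T.Nonempty)
    (h : ∀ i ∈ T, ∀ j ∉ T, symMatrix A d i j = 0) : T = Finset.univ := by
  by_contra hne
  obtain ⟨i, hi, j, hj, hij⟩ := hA.indecomposable T (Finset.subset_univ _) hT hne
  have h0 := hA.symMatrix_eq_zero_iff.1 (h i hi j (Finset.mem_sdiff.1 hj).2)
  exact hij.elim (· h0) (· (hA.gcm.zero _ _ h0))

/-- On an indecomposable proper S the form is of finite or affine type, hence semidefinite;
otherwise S splits into two orthogonal parts and induction applies to each. -/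
theorem realForm_nonneg_of_support (hA : IsHyperbolic A d) (S : Finset ι) (hS : S ≠ Finset.univ) :
    ∀ x : ι → ℝ, (∀ i, i ∉ S → x i = 0) → 0 ≤ realForm A d x x := by
  induction S using Finset.strongInduction with
  | H S ih =>
    intro x hx
    by_cases hind : IndecomposableOn A S
    · have hpsd : (principal (symMatrix A d) S).PosSemidef := by
        rcases hA.proper_sub S hS hind with h | h
        · exact Matrix.PosDef.posSemidef h
        · exact h.1
      have h := hpsd.dotProduct_mulVec_nonneg (fun i : S => x i)
      have hsum : ∀ f : ι → ℝ, (∀ i, i ∉ S → f i = 0) → ∑ i, f i = ∑ i : S, f i := fun f hf => by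
        rw [Finset.sum_coe_sort S f]
        exact (Finset.sum_subset (Finset.subset_univ _) fun i _ hi => hf i hi).symm
      rw [realForm_apply, hsum _ fun i hi => by simp [hx i hi]]
      refine h.trans_eq (Finset.sum_congr rfl fun i _ => ?_)
      rw [hsum _ fun i hi => by simp [hx i hi]]
      simp [Matrix.mulVec, dotProduct, principal, Finset.mul_sum, mul_assoc]
    · simp only [IndecomposableOn, not_forall] at hind
      obtain ⟨T, hTS, hTne, hT, hlink⟩ := hind
      push Not at hlink
      set y : ι → ℝ := fun i => if i ∈ T then x i else 0 with hy
      set z : ι → ℝ := fun i => if i ∈ T then 0 else x i with hz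
      have hxyz : x = y + z := by
        funext i
        by_cases hi : i ∈ T <;> simp [hy, hz, hi]
      have hTS' : T ⊂ S := hTS.ssubset_of_ne hT
      have hST : S \ T ⊂ S := Finset.sdiff_ssubset hTS hTne
      have hy0 : 0 ≤ realForm A d y y :=
        ih T hTS' (fun h => hTS'.2 (h ▸ Finset.subset_univ _)) y fun i hi => by simp [hy, hi]
      have hz0 : 0 ≤ realForm A d z z := by
        refine ih (S \ T) hST (fun h => hST.2 (h ▸ Finset.subset_univ _)) z fun i hi => ?_
        by_cases hiT : i ∈ T
        · simp [hz, hiT]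
        · have : i ∉ S := fun h => hi (Finset.mem_sdiff.2 ⟨h, hiT⟩)
          simp [hz, hx i this]
      have hyz : realForm A d y z = 0 := by
        rw [realForm_apply]
        refine Finset.sum_eq_zero fun i _ => Finset.sum_eq_zero fun j _ => ?_
        by_cases hi : i ∈ T
        · by_cases hj : j ∈ T
          · simp [hz, hj]
          · by_cases hjS : j ∈ S
            · have := hA.symMatrix_eq_zero_iff.2 (hlink i hi j (Finset.mem_sdiff.2 ⟨hjS, hj⟩)).1
              simp [this]
            · simp [hz, hx j hjS]
        · simp [hy, hi]
      rw [hxyz, hA.realForm_add_self, hyz]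
      linarith

theorem realForm_nonneg (hA : IsHyperbolic A d) {x : ι → ℝ} {l : ι} (hl : x l = 0) :
    0 ≤ realForm A d x x := by
  refine hA.realForm_nonneg_of_support (Finset.univ.erase l) ?_ x fun i hi => ?_
  · intro h
    have := Finset.mem_univ l
    rw [← h] at this
    simp at this
  · have : i = l := by simpa using hi
    rw [this, hl]

theorem realForm_abs_le (hA : IsHyperbolic A d) (x : ι → ℝ) :
    realForm A d |x| |x| ≤ realForm A d x x := by
  rw [realForm_apply, realForm_apply]
  refine Finset.sum_le_sum fun i _ => Finset.sum_le_sum fun j _ => ?_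
  simp only [Pi.abs_apply]
  rcases eq_or_ne i j with rfl | hij
  · rw [mul_right_comm, abs_mul_abs_self, mul_right_comm]
  · have h1 := hA.symMatrix_nonpos hij
    have h2 : x i * x j ≤ |x i| * |x j| := (le_abs_self _).trans_eq (abs_mul _ _)
    nlinarith

/-- If `x ≥ 0` is orthogonal to all simple roots outside its support, its support is everything. -/
theorem support_full_of_orthogonal (hA : IsHyperbolic A d) {x : ι → ℝ} (hx : 0 ≤ x) (hx0 : x ≠ 0)
    (h : ∀ l, x l = 0 → 0 ≤ realForm A d (Pi.single l 1) x) (l : ι) : x l ≠ 0 := by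
  classical
  set T : Finset ι := Finset.univ.filter fun i => x i ≠ 0 with hT
  have hTu : T = Finset.univ := by
    refine hA.eq_univ_of_unlinked ?_ fun i hi j hj => ?_
    · obtain ⟨i, hi⟩ := Function.ne_iff.1 hx0
      exact ⟨i, by simpa [hT] using hi⟩
    · have hxi : x i ≠ 0 := by simpa [hT] using hi
      have hxj : x j = 0 := by simpa [hT] using hj
      -- The product of α_j with x is a sum of nonpositive terms but is itself nonnegative, so every
      -- term vanishes and j is linked to nothing in the support.
      have hterm : ∀ k ∈ Finset.univ, symMatrix A d j k * x k ≤ 0 := fun k _ => by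
        rcases eq_or_ne j k with rfl | hjk
        · simp [hxj]
        · exact mul_nonpos_of_nonpos_of_nonneg (hA.symMatrix_nonpos hjk) (hx k)
      have hs := h j hxj
      rw [realForm_single_left] at hs
      have h0 := (Finset.sum_eq_zero_iff_of_nonpos hterm).1
        (le_antisymm (Finset.sum_nonpos hterm) hs) i (Finset.mem_univ _)
      rw [hA.symmetrizer.symMatrix_comm]
      exact (mul_eq_zero.1 h0).resolve_right hxi
  have := Finset.mem_univ l
  rw [← hTu] at this
  simpa [hT] using this

/-- With s = (α_l | x), the square of x + tα_l is 2ts + t²B_ll; at its minimum t = -s/B_ll it equals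
-s²/B_ll. -/
theorem exists_realForm_add_neg (hA : IsHyperbolic A d) {x : ι → ℝ} (hx : realForm A d x x = 0)
    {l : ι} (hl : realForm A d (Pi.single l 1) x < 0) :
    ∃ t : ℝ, realForm A d (x + t • Pi.single l 1) (x + t • Pi.single l 1) < 0 := by
  have hB := hA.symMatrix_diag_pos l
  set s := realForm A d (Pi.single l 1) x with hs
  refine ⟨-s / symMatrix A d l l, ?_⟩
  set t : ℝ := -s / symMatrix A d l l with ht
  have hts : t * symMatrix A d l l = -s := by rw [ht]; field_simp
  have ht0 : 0 < t := div_pos (by linarith) hB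
  rw [hA.realForm_add_self, hx]
  simp only [map_smul, LinearMap.smul_apply, smul_eq_mul, realForm_single_single,
    hA.realForm_comm x, ← hs, hts]
  nlinarith

/-- A nonzero vector with two vanishing coordinates has positive square. -/
theorem realForm_pos_of_two_zeros (hA : IsHyperbolic A d) {x : ι → ℝ} (hx0 : x ≠ 0) {a b : ι}
    (hab : a ≠ b) (ha : x a = 0) (hb : x b = 0) : 0 < realForm A d x x := by
  refine lt_of_lt_of_le ?_ (hA.realForm_abs_le x)
  have ha' : |x| a = 0 := by simp [ha]
  have hb' : |x| b = 0 := by simp [hb]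
  refine lt_of_le_of_ne (hA.realForm_nonneg ha') fun h0 => ?_
  refine hA.support_full_of_orthogonal (abs_nonneg x) (by simpa using hx0) (fun l hl => ?_) a ha'
  by_contra! hneg
  obtain ⟨t, hsq⟩ := hA.exists_realForm_add_neg h0.symm hneg
  refine absurd hsq (not_lt.2 ?_)
  -- The shift changes only the coordinate l, so the shifted vector still vanishes at a or at b.
  rcases eq_or_ne l a with rfl | hla
  · exact hA.realForm_nonneg (l := b) (by simp [hb, hab.symm])
  · exact hA.realForm_nonneg (l := a) (by simp [ha, hla.symm])

theorem realForm_smul_single_pos (hA : IsHyperbolic A d) {x : ι → ℝ} {i : ι} (hi : x i ≠ 0)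
    (h : ∀ j, j ≠ i → x j = 0) : 0 < realForm A d x x := by
  have hx : x = x i • Pi.single i 1 := by
    funext j
    rcases eq_or_ne j i with rfl | hj
    · simp
    · simp [h j hj, hj]
  rw [hx]
  simp only [map_smul, LinearMap.smul_apply, smul_eq_mul, realForm_single_single, ← mul_assoc]
  exact mul_pos (mul_self_pos.2 hi) (hA.symMatrix_diag_pos i)

/-- A vector with coordinates of both signs has positive square. -/
theorem realForm_pos_of_mixed (hA : IsHyperbolic A d) {x : ι → ℝ} {i j : ι} (hi : 0 < x i)
    (hj : x j < 0) : 0 < realForm A d x x := by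
  have hpj : x⁺ j = 0 := by simp [hj.le]
  have hqi : x⁻ i = 0 := by simp [hi.le]
  have hp := hA.realForm_nonneg hpj
  have hq := hA.realForm_nonneg hqi
  have hpi : x⁺ i ≠ 0 := by simp [hi]
  have hqj : x⁻ j ≠ 0 := by simp [hj]
  have hij : i ≠ j := by
    rintro rfl
    exact lt_asymm hi hj
  have hpq : realForm A d x⁺ x⁻ ≤ 0 := by
    rw [realForm_apply]
    refine Finset.sum_nonpos fun k _ => Finset.sum_nonpos fun l _ => ?_
    rcases eq_or_ne k l with rfl | hkl
    · rcases le_total (x k) 0 with h | h <;> simp [h]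
    · exact mul_nonpos_of_nonpos_of_nonneg (mul_nonpos_of_nonneg_of_nonpos (posPart_nonneg x k)
        (hA.symMatrix_nonpos hkl)) (negPart_nonneg x l)
  have hx : realForm A d x x = realForm A d x⁺ x⁺ - 2 * realForm A d x⁺ x⁻ +
      realForm A d x⁻ x⁻ := by
    rw [← hA.realForm_sub_self, posPart_sub_negPart]
  -- At a third index l one of x⁺, x⁻ vanishes, which gives it a second zero. Without a third index,
  -- x⁺ is a multiple of a simple root.
  by_cases hthird : ∃ l, l ≠ i ∧ l ≠ j
  · obtain ⟨l, hli, hlj⟩ := hthird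
    rcases le_total (x l) 0 with h | h
    · have := hA.realForm_pos_of_two_zeros (x := x⁺) (fun h => hpi (congrFun h i)) hlj
        (by simp [h]) hpj
      linarith
    · have := hA.realForm_pos_of_two_zeros (x := x⁻) (fun h => hqj (congrFun h j)) hli
        (by simp [h]) hqi
      linarith
  · push Not at hthird
    have := hA.realForm_smul_single_pos (x := x⁺) hpi fun l hl => by rw [hthird l hl, hpj]
    linarith

/-! ### Lorentzian signature -/

theorem symMatrix_isHermitian (hA : IsHyperbolic A d) : (symMatrix A d).IsHermitian := by
  ext i j
  simpa using hA.symmetrizer.symMatrix_comm j i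

/-- A vector in the radical of a positive semidefinite invariant form vanishes if one of its
coordinates does. -/
theorem eq_zero_of_realForm_eq_zero (hA : IsHyperbolic A d)
    (hpsd : ∀ x, 0 ≤ realForm A d x x) {x : ι → ℝ} (hx : realForm A d x x = 0) {l : ι}
    (hl : x l = 0) : x = 0 := by
  by_contra hx0
  have habs : realForm A d |x| |x| = 0 :=
    le_antisymm ((hA.realForm_abs_le x).trans_eq hx) (hpsd _)
  refine hA.support_full_of_orthogonal (abs_nonneg x) (by simpa using hx0) (fun m _ => ?_) l
    (by simp [hl])
  by_contra! hneg
  obtain ⟨t, hsq⟩ := hA.exists_realForm_add_neg habs hneg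
  exact hsq.not_ge (hpsd _)

/-- A semidefinite form would be of finite type if it had no null vector. If it has one, any two
null vectors are proportional, since a combination with a vanishing coordinate is null and hence
zero; the kernel is then a line and the type affine. -/
theorem exists_realForm_neg (hA : IsHyperbolic A d) : ∃ x, realForm A d x x < 0 := by
  by_contra! hpsd
  have happ : ∀ x : ι → ℝ, star x ⬝ᵥ (symMatrix A d).mulVec x = realForm A d x x := fun x => by
    rw [realForm, Matrix.toBilin'_apply', star_trivial]
  have hPSD : (symMatrix A d).PosSemidef :=
    .of_dotProduct_mulVec_nonneg hA.symMatrix_isHermitian fun x => (happ x).symm ▸ hpsd x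
  have hnull : ∃ x : ι → ℝ, x ≠ 0 ∧ realForm A d x x = 0 := by
    by_contra! h
    exact hA.indefinite.1 (.of_dotProduct_mulVec_pos hA.symMatrix_isHermitian fun x hx =>
      (happ x).symm ▸ lt_of_le_of_ne (hpsd x) (h x hx).symm)
  obtain ⟨x, hx0, hx⟩ := hnull
  obtain ⟨l, hl⟩ := Function.ne_iff.1 hx0
  have hker : ∀ y, (symMatrix A d).mulVec y = 0 → realForm A d y y = 0 := fun y hy => by
    rw [← happ, hy, dotProduct_zero]
  have hxker : (symMatrix A d).mulVec x = 0 := by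
    rw [← hPSD.dotProduct_mulVec_zero_iff, happ, hx]
  refine hA.indefinite.2 ⟨hPSD, ?_⟩
  have hrn := (symMatrix A d).mulVecLin.finrank_range_add_finrank_ker
  have hone : Module.finrank ℝ (LinearMap.ker (symMatrix A d).mulVecLin) = 1 := by
    refine finrank_eq_one ⟨x, by simpa using hxker⟩ (by simpa using hx0) ?_
    rintro ⟨y, hy⟩
    refine ⟨y l / x l, Subtype.ext ?_⟩
    have hy' : (symMatrix A d).mulVec y = 0 := by simpa using hy
    have h0 : (y l / x l) • x - y = 0 := by
      refine hA.eq_zero_of_realForm_eq_zero hpsd (l := l) (hker _ ?_) ?_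
      · rw [Matrix.mulVec_sub, Matrix.mulVec_smul, hxker, hy', smul_zero, sub_zero]
      · have : x l ≠ 0 := hl
        simp [this]
    simpa using sub_eq_zero.1 h0
  rw [hone, Module.finrank_fintype_fun_eq_card] at hrn
  exact hrn

/-- The orthogonal complement of a vector of negative square is positive definite. -/
theorem realForm_pos_of_orthogonal (hA : IsHyperbolic A d) {x u : ι → ℝ}
    (hx : realForm A d x x < 0) (hu : realForm A d u x = 0) (hu0 : u ≠ 0) :
    0 < realForm A d u u := by
  by_contra! hneg
  have hmix : ∃ i j, x i * u j - x j * u i ≠ 0 := by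
    by_contra! h
    have hx0 : x ≠ 0 := by
      rintro rfl
      simp at hx
    obtain ⟨i, hi⟩ := Function.ne_iff.1 hx0
    have hi : x i ≠ 0 := hi
    have hux : u = (u i / x i) • x := by
      funext j
      have := h i j
      simp only [Pi.smul_apply, smul_eq_mul]
      field_simp
      linarith
    have h0 : u i / x i = 0 := by
      have h1 := hu
      rw [hux, map_smul, LinearMap.smul_apply, smul_eq_mul] at h1
      exact (mul_eq_zero.1 h1).resolve_right hx.ne
    rw [h0, zero_smul] at hux
    exact hu0 hux
  obtain ⟨i, j, hij⟩ := hmix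
  -- Cramer's rule finds a vector with coordinates 1 and -1 in the plane of x and u. Being mixed it
  -- has positive square, although the form would be nonpositive on this plane.
  set D := x i * u j - x j * u i with hD
  set s := (u j + u i) / D with hs
  set t := -(x i + x j) / D with ht
  have hi : (s • x + t • u) i = 1 := by
    simp only [Pi.add_apply, Pi.smul_apply, smul_eq_mul, hs, ht]
    field_simp
    rw [hD]
    ring
  have hj : (s • x + t • u) j = -1 := by
    simp only [Pi.add_apply, Pi.smul_apply, smul_eq_mul, hs, ht]
    field_simp
    rw [hD]
    ring
  have hpos := hA.realForm_pos_of_mixed (x := s • x + t • u) (i := i) (j := j)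
    (by rw [hi]; norm_num) (by rw [hj]; norm_num)
  rw [hA.realForm_add_self] at hpos
  simp only [map_smul, LinearMap.smul_apply, smul_eq_mul, hA.realForm_comm x u, hu] at hpos
  nlinarith [mul_self_nonneg s, mul_self_nonneg t, mul_nonpos_of_nonneg_of_nonpos
    (mul_self_nonneg s) hx.le, mul_nonpos_of_nonneg_of_nonpos (mul_self_nonneg t) hneg]

end IsHyperbolic

/-! ### The invariant form on the root lattice -/

/-- The embedding of the root lattice into its real span. -/
def toReal : (ι → ℤ) →+ (ι → ℝ) := (Int.castAddHom ℝ).compLeft ι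

@[simp]
theorem toReal_apply (x : ι → ℤ) (i : ι) : toReal x i = (x i : ℝ) := rfl

theorem toReal_injective : Function.Injective (toReal : (ι → ℤ) →+ (ι → ℝ)) := fun x y h => by
  funext i
  exact Int.cast_injective (congrFun h i)

@[simp]
theorem toReal_simpleRoot (i : ι) : toReal (simpleRoot i) = Pi.single i (1 : ℝ) := by
  funext j
  rcases eq_or_ne j i with rfl | h
  · simp [simpleRoot]
  · simp [simpleRoot, h]

theorem toReal_zsmul (n : ℤ) (x : ι → ℤ) : toReal (n • x) = (n : ℝ) • toReal x := by
  funext i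
  simp

theorem form_eq_realForm (A : Matrix ι ι ℤ) (d : ι → ℝ) (x y : ι → ℤ) :
    form A d x y = realForm A d (toReal x) (toReal y) := by
  rw [realForm_apply]
  rfl

section

variable (A : Matrix ι ι ℤ) (d : ι → ℝ)

theorem form_sub_left (x y z : ι → ℤ) : form A d (x - y) z = form A d x z - form A d y z := by
  simp [form_eq_realForm]

theorem form_sub_right (x y z : ι → ℤ) : form A d x (y - z) = form A d x y - form A d x z := by
  simp [form_eq_realForm]

theorem form_neg_left (x y : ι → ℤ) : form A d (-x) y = -form A d x y := by
  simp [form_eq_realForm]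

theorem form_neg_right (x y : ι → ℤ) : form A d x (-y) = -form A d x y := by
  simp [form_eq_realForm]

theorem form_zsmul_left (n : ℤ) (x y : ι → ℤ) : form A d (n • x) y = n * form A d x y := by
  rw [form_eq_realForm, toReal_zsmul, map_smul, LinearMap.smul_apply, smul_eq_mul,
    form_eq_realForm]

theorem form_eq_sum (x y : ι → ℤ) :
    form A d x y = ∑ i, (x i : ℝ) * form A d (simpleRoot i) y := by
  simp_rw [form_eq_realForm, toReal_simpleRoot]
  exact realForm_eq_sum A d _ _

theorem form_simpleRoot_left (i : ι) (x : ι → ℤ) :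
    form A d (simpleRoot i) x = d i * ((∑ j, A i j * x j : ℤ) : ℝ) := by
  rw [form_eq_realForm, toReal_simpleRoot, realForm_single_left]
  push_cast
  rw [Finset.mul_sum]
  exact Finset.sum_congr rfl fun j _ => by simp [symMatrix, mul_assoc]

end

namespace IsHyperbolic

variable {A : Matrix ι ι ℤ} {d : ι → ℝ}

theorem form_comm (hA : IsHyperbolic A d) (x y : ι → ℤ) : form A d x y = form A d y x := by
  rw [form_eq_realForm, form_eq_realForm, hA.realForm_comm]

theorem form_simpleRoot_self (hA : IsHyperbolic A d) (i : ι) :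
    form A d (simpleRoot i) (simpleRoot i) = 2 * d i := by
  rw [form_eq_realForm, toReal_simpleRoot, realForm_single_single]
  simp [symMatrix, hA.gcm.diag i, mul_comm]

theorem form_simpleRoot_self_pos (hA : IsHyperbolic A d) (i : ι) :
    0 < form A d (simpleRoot i) (simpleRoot i) := by
  rw [hA.form_simpleRoot_self]
  linarith [hA.symmetrizer.pos i]

/-- In rank one the form would be positive definite. -/
theorem exists_ne (hA : IsHyperbolic A d) (i : ι) : ∃ j, j ≠ i := by
  by_contra! h
  obtain ⟨x, hx⟩ := hA.exists_realForm_neg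
  have hxi : x i ≠ 0 := fun h0 => by
    have : x = 0 := by
      funext j
      rw [h j, h0, Pi.zero_apply]
    simp [this] at hx
  exact lt_asymm hx (hA.realForm_smul_single_pos hxi fun j hj => absurd (h j) hj)

end IsHyperbolic

/-! ### Reflection-stable sets without simple roots -/

/-- The sum of the absolute values of the coordinates. -/
def size (x : ι → ℤ) : ℕ := ∑ i, (x i).natAbs

theorem size_neg (x : ι → ℤ) : size (-x) = size x := by simp [size]

theorem sub_zsmul_simpleRoot_apply_self (x : ι → ℤ) (m : ℤ) (i : ι) :
    (x - m • simpleRoot i) i = x i - m := by simp [simpleRoot]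

theorem sub_zsmul_simpleRoot_apply_of_ne (x : ι → ℤ) (m : ℤ) {i j : ι} (h : j ≠ i) :
    (x - m • simpleRoot i) j = x j := by simp [simpleRoot, h]

theorem sub_simpleRoot_apply_self (x : ι → ℤ) (i : ι) :
    (x - simpleRoot i) i = x i - 1 := by simp [simpleRoot]

theorem sub_simpleRoot_apply_of_ne (x : ι → ℤ) {i j : ι} (h : j ≠ i) :
    (x - simpleRoot i) j = x j := by simp [simpleRoot, h]

theorem size_sub_zsmul_lt {x : ι → ℤ} {m : ℤ} {i : ι} (hm : 0 < m) (hm' : m < 2 * x i) :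
    size (x - m • simpleRoot i) < size x := by
  refine Finset.sum_lt_sum (fun j _ => ?_) ⟨i, Finset.mem_univ _, ?_⟩
  · rcases eq_or_ne j i with rfl | h
    · rw [sub_zsmul_simpleRoot_apply_self]
      omega
    · rw [sub_zsmul_simpleRoot_apply_of_ne _ _ h]
  · rw [sub_zsmul_simpleRoot_apply_self]
    omega

theorem size_sub_lt {x : ι → ℤ} {i : ι} (hx : 0 < x i) : size (x - simpleRoot i) < size x := by
  simpa using size_sub_zsmul_lt (x := x) (m := 1) (i := i) one_pos (by omega)

/-- A set of vectors of positive square, stable under simple reflections, which contains no simple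
root, such that `α - α_i` is in the set whenever `α` is and `(α | α_i)` is positive and small. -/
structure IsDescentSet (A : Matrix ι ι ℤ) (d : ι → ℝ) (X : Set (ι → ℤ)) : Prop where
  neg_mem : ∀ α ∈ X, -α ∈ X
  form_pos : ∀ α ∈ X, 0 < form A d α α
  simpleRoot_notMem : ∀ i, simpleRoot i ∉ X
  sub_mem : ∀ α ∈ X, ∀ i, 0 < form A d α (simpleRoot i) → α - simpleRoot i ∈ X ∨
    (form A d α α ≤ form A d α (simpleRoot i) ∧
      form A d (simpleRoot i) (simpleRoot i) ≤ form A d α (simpleRoot i))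
  reflection_mem : ∀ α ∈ X, ∀ i, ∃ m : ℤ, 2 * form A d α (simpleRoot i) =
    m * form A d (simpleRoot i) (simpleRoot i) ∧ α - m • simpleRoot i ∈ X

namespace IsDescentSet

variable {A : Matrix ι ι ℤ} {d : ι → ℝ} {X : Set (ι → ℤ)}

/-- It suffices to refute positive coordinates `α i > 0` with `(α | α_i) > 0`, for `α` and `-α`. -/
theorem false_of_positive (hA : IsHyperbolic A d) (hX : IsDescentSet A d X) {α : ι → ℤ}
    (hα : α ∈ X) (h : ∀ i, 0 < α i → 0 < form A d α (simpleRoot i) → False)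
    (h' : ∀ i, 0 < (-α) i → 0 < form A d (-α) (simpleRoot i) → False) : False := by
  refine (hX.form_pos α hα).not_ge ?_
  -- Expand one factor: (α | α) = ∑ α_i (α | α_i). If no α_i and (α | α_i) have the same strict
  -- sign, this is not positive.
  rw [form_eq_sum]
  refine Finset.sum_nonpos fun i _ => ?_
  rw [hA.form_comm]
  rcases lt_trichotomy (α i) 0 with hi | hi | hi
  · refine mul_nonpos_of_nonpos_of_nonneg (by exact_mod_cast hi.le) ?_
    by_contra! hneg
    exact h' i (by simpa using hi) (by rw [form_neg_left]; linarith)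
  · simp [hi]
  · refine mul_nonpos_of_nonneg_of_nonpos (by exact_mod_cast hi.le) ?_
    by_contra! hpos
    exact h i hi hpos

theorem form_sub_self (hA : IsHyperbolic A d) (x y : ι → ℤ) :
    form A d (x - y) (x - y) = form A d x x - 2 * form A d x y + form A d y y := by
  simp only [form_sub_left, form_sub_right, hA.form_comm y x]
  ring

/-- Descent among elements with vanishing coordinate l: subtracting α_i or reflecting in it, with i
≠ l, keeps that coordinate zero and lowers the size. -/
theorem apply_ne_zero (hA : IsHyperbolic A d) (hX : IsDescentSet A d X) (l : ι) {α : ι → ℤ}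
    (hα : α ∈ X) : α l ≠ 0 := by
  induction hn : size α using Nat.strong_induction_on generalizing α with
  | _ n ih =>
    subst hn
    have key : ∀ β ∈ X, size β = size α → β l = 0 → ∀ i, 0 < β i →
        0 < form A d β (simpleRoot i) → False := by
      intro β hβ hsize hl i hi hpos
      have hli : l ≠ i := by
        rintro rfl
        omega
      rcases hX.sub_mem β hβ i hpos with hmem | ⟨h1, h2⟩
      · exact ih _ (hsize ▸ size_sub_lt hi) hmem rfl (by
          rw [sub_simpleRoot_apply_of_ne _ hli, hl])
      · have hp : 0 ≤ form A d (β - simpleRoot i) (β - simpleRoot i) := by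
          rw [form_eq_realForm]
          refine hA.realForm_nonneg (l := l) ?_
          rw [toReal_apply, sub_simpleRoot_apply_of_ne _ hli, hl, Int.cast_zero]
        rw [form_sub_self hA] at hp
        obtain ⟨m, hm, hmem⟩ := hX.reflection_mem β hβ i
        have hm2 : m = 2 := by
          have h3 : form A d (simpleRoot i) (simpleRoot i) = form A d β (simpleRoot i) := by
            linarith
          rw [h3] at hm
          have := mul_right_cancel₀ hpos.ne' hm
          exact_mod_cast this.symm
        subst hm2
        -- Now β - α_i is isotropic and the reflection of β is β - 2α_i, which is smaller than β
        -- unless β i = 1. In that case β - α_i vanishes at both l and i, so it is zero and β is a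
        -- simple root.
        have hi1 : β i = 1 := by
          by_contra hne
          exact ih _ (hsize ▸ size_sub_zsmul_lt two_pos (by omega)) hmem rfl (by
            rw [sub_zsmul_simpleRoot_apply_of_ne _ _ hli, hl])
        by_cases hzero : β - simpleRoot i = 0
        · exact hX.simpleRoot_notMem i (sub_eq_zero.1 hzero ▸ hβ)
        · have := hA.realForm_pos_of_two_zeros (x := toReal (β - simpleRoot i))
            (fun h => hzero (toReal_injective (h.trans (map_zero _).symm))) hli
            (by rw [toReal_apply, sub_simpleRoot_apply_of_ne _ hli, hl, Int.cast_zero])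
            (by rw [toReal_apply, sub_simpleRoot_apply_self, hi1, sub_self, Int.cast_zero])
          rw [← form_eq_realForm, form_sub_self hA] at this
          linarith
    intro hl
    exact false_of_positive hA hX hα (key α hα rfl hl)
      (key (-α) (hX.neg_mem α hα) (size_neg α) (by simp [hl]))

/-- In a mixed element of minimal size, a positive coordinate `α i` with `(α | α_i) > 0` is `1` and
the only positive coordinate. -/
theorem apply_eq_one_of_minimal_mixed (hA : IsHyperbolic A d) (hX : IsDescentSet A d X)
    {α : ι → ℤ} (hα : α ∈ X)
    (hmin : ∀ β ∈ X, size β < size α → ∀ i j, 0 < β i → β j < 0 → False)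
    {i j : ι} (hi : 0 < α i) (hj : α j < 0) (hpos : 0 < form A d α (simpleRoot i)) :
    α i = 1 ∧ (∀ l, l ≠ i → α l < 0) ∧ form A d α α ≤ form A d α (simpleRoot i) := by
  have hji : j ≠ i := by
    rintro rfl
    omega
  -- Either α - α_i is in X, hence nonzero at i and still mixed, against minimality; or its square
  -- is nonpositive, so it is not mixed and all its coordinates are nonpositive.
  rcases hX.sub_mem α hα i hpos with hmem | ⟨h1, h2⟩
  · have h0 := apply_ne_zero hA hX i hmem
    rw [sub_simpleRoot_apply_self] at h0
    exact (hmin _ hmem (size_sub_lt hi) i j (by rw [sub_simpleRoot_apply_self]; omega)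
      (by rwa [sub_simpleRoot_apply_of_ne _ hji])).elim
  · have hnm : ∀ l, (α - simpleRoot i) l ≤ 0 := by
      intro l
      by_contra! hl
      have := hA.realForm_pos_of_mixed (x := toReal (α - simpleRoot i)) (i := l) (j := j)
        (by rw [toReal_apply]; exact_mod_cast hl)
        (by rw [toReal_apply, sub_simpleRoot_apply_of_ne _ hji]; exact_mod_cast hj)
      rw [← form_eq_realForm, form_sub_self hA] at this
      linarith
    refine ⟨?_, fun l hl => ?_, h1⟩
    · have := hnm i
      rw [sub_simpleRoot_apply_self] at this
      omega
    · have := hnm l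
      rw [sub_simpleRoot_apply_of_ne _ hl] at this
      exact lt_of_le_of_ne this (apply_ne_zero hA hX l hα)

/-- Here α is α_i minus a nonnegative q with q_i = 0. If `apply_eq_one_of_minimal_mixed` also
applies to -α, the rank is two and α = α_i - α_k, which forces (α | α) ≥ 2(α | α). Otherwise (α_i |
q) = (q | q) + (α | q) ≥ 0, and `support_full_of_orthogonal` contradicts q_i = 0. -/
theorem not_mixed_of_minimal (hA : IsHyperbolic A d) (hX : IsDescentSet A d X)
    {α : ι → ℤ} (hα : α ∈ X)
    (hmin : ∀ β ∈ X, size β < size α → ∀ i j, 0 < β i → β j < 0 → False)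
    {i j : ι} (hi : 0 < α i) (hj : α j < 0) (hpos : 0 < form A d α (simpleRoot i)) : False := by
  obtain ⟨hi1, hneg, hle⟩ := apply_eq_one_of_minimal_mixed hA hX hα hmin hi hj hpos
  by_cases hex : ∃ k, α k < 0 ∧ form A d α (simpleRoot k) < 0
  · obtain ⟨k, hk, hkneg⟩ := hex
    obtain ⟨hk1, hpos', hle'⟩ := apply_eq_one_of_minimal_mixed hA hX (hX.neg_mem α hα)
      (size_neg α ▸ hmin) (i := k) (j := i) (by simpa using hk) (by simpa using hi)
      (by rw [form_neg_left]; linarith)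
    have hki : k ≠ i := by
      rintro rfl
      omega
    have huniv : (Finset.univ : Finset ι) = {i, k} := by
      ext l
      simp only [Finset.mem_univ, Finset.mem_insert, Finset.mem_singleton, true_iff]
      by_contra! h
      have h3 := hneg l h.1
      have h4 := hpos' l h.2
      rw [Pi.neg_apply] at h4
      omega
    have hsum := form_eq_sum A d α α
    have hk1' : α k = -1 := by
      rw [Pi.neg_apply] at hk1
      omega
    rw [huniv, Finset.sum_pair hki.symm, hi1, hk1', hA.form_comm (simpleRoot i),
      hA.form_comm (simpleRoot k)] at hsum
    simp only [form_neg_left, form_neg_right, neg_neg] at hle'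
    have := hX.form_pos α hα
    push_cast at hsum
    linarith
  · push Not at hex
    set q : ι → ℤ := simpleRoot i - α with hq
    have hqi : q i = 0 := by simp [hq, simpleRoot, hi1]
    have hql : ∀ l, l ≠ i → 0 < q l := fun l hl => by
      have := hneg l hl
      simp [hq, simpleRoot, hl, this]
    have hqq : 0 ≤ form A d q q := by
      rw [form_eq_realForm]
      exact hA.realForm_nonneg (l := i) (by simp [hqi])
    have hqα : 0 ≤ form A d q α := by
      rw [form_eq_sum]
      refine Finset.sum_nonneg fun l _ => ?_
      rcases eq_or_ne l i with rfl | hl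
      · simp [hqi]
      · rw [hA.form_comm]
        exact mul_nonneg (by exact_mod_cast (hql l hl).le) (hex l (hneg l hl))
    have hiq : 0 ≤ form A d (simpleRoot i) q := by
      have : simpleRoot i = q - -α := by simp [hq]
      rw [this, form_sub_left, form_neg_left, hA.form_comm α q]
      linarith
    have hji : j ≠ i := by
      rintro rfl
      omega
    refine hA.support_full_of_orthogonal (x := toReal q) (fun l => ?_) (fun h => ?_)
      (fun l hl => ?_) i (by simp [hqi])
    · rcases eq_or_ne l i with rfl | hl
      · simp [hqi]
      · exact Int.cast_nonneg (hql l hl).le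
    · have := congrFun h j
      rw [toReal_apply, Pi.zero_apply, Int.cast_eq_zero] at this
      exact (hql j hji).ne' this
    · rcases eq_or_ne l i with rfl | hli
      · rwa [← toReal_simpleRoot, ← form_eq_realForm]
      · rw [toReal_apply, Int.cast_eq_zero] at hl
        exact ((hql l hli).ne' hl).elim

theorem not_mixed (hA : IsHyperbolic A d) (hX : IsDescentSet A d X) {α : ι → ℤ} (hα : α ∈ X)
    {i j : ι} (hi : 0 < α i) (hj : α j < 0) : False := by
  induction hn : size α using Nat.strong_induction_on generalizing α i j with
  | _ n ih =>
    subst hn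
    have hmin : ∀ β ∈ X, size β < size α → ∀ i j, 0 < β i → β j < 0 → False :=
      fun β hβ hlt i j hi hj => ih _ hlt hβ hi hj rfl
    exact false_of_positive hA hX hα (fun k hk => not_mixed_of_minimal hA hX hα hmin hk hj)
      fun k hk => not_mixed_of_minimal hA hX (hX.neg_mem α hα) (size_neg α ▸ hmin) hk
        (j := i) (by simpa using hi)

/-- All coordinates of an element are nonzero and of one sign. A reflection in α_i leaves the other
coordinates alone, so it cannot change the sign at i either; when it lowers that coordinate it
therefore lowers the size. -/
theorem eq_empty (hA : IsHyperbolic A d) (hX : IsDescentSet A d X) : X = ∅ := by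
  refine Set.eq_empty_iff_forall_notMem.2 fun α hα => ?_
  induction hn : size α using Nat.strong_induction_on generalizing α with
  | _ n ih =>
    subst hn
    have key : ∀ β ∈ X, size β = size α → ∀ i, 0 < β i →
        0 < form A d β (simpleRoot i) → False := by
      intro β hβ hsize i hi hpos
      obtain ⟨m, hm, hmem⟩ := hX.reflection_mem β hβ i
      have hm0 : 0 < m := by
        have := hA.form_simpleRoot_self_pos i
        have h : (0 : ℝ) < m := by
          by_contra! h
          nlinarith
        exact_mod_cast h
      obtain ⟨j, hj⟩ := hA.exists_ne i
      have hβj : 0 < β j := by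
        rcases lt_trichotomy (β j) 0 with h | h | h
        · exact (not_mixed hA hX hβ hi h).elim
        · exact (apply_ne_zero hA hX j hβ h).elim
        · exact h
      have h0 := apply_ne_zero hA hX i hmem
      have hnn : ¬ (β - m • simpleRoot i) i < 0 := fun h =>
        not_mixed hA hX hmem (i := j) (by rwa [sub_zsmul_simpleRoot_apply_of_ne _ _ hj]) h
      rw [sub_zsmul_simpleRoot_apply_self] at h0 hnn
      exact ih _ (hsize ▸ size_sub_zsmul_lt hm0 (by omega)) _ hmem rfl
    exact false_of_positive hA hX hα (key α hα rfl) (key (-α) (hX.neg_mem α hα) (size_neg α))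

end IsDescentSet

/-! ### Reflections and real roots -/

/-- An integer matrix respects real proportionality. This is needed because the coefficient of a
reflection in a lattice vector v need not be an integer. -/
theorem toReal_map_of_smul (f : (κ → ℤ) →ₗ[ℤ] (ι → ℤ)) {x y : κ → ℤ} {c : ℝ}
    (h : toReal x = c • toReal y) : toReal (f x) = c • toReal (f y) := by
  funext i
  have hx : ∀ j, (x j : ℝ) = c * y j := fun j => congrFun h j
  rw [toReal_apply, Pi.smul_apply, toReal_apply, f.pi_apply_eq_sum_univ x,
    f.pi_apply_eq_sum_univ y]
  simp [hx, Finset.mul_sum, mul_assoc]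

namespace IsReflectionIn

variable {A : Matrix ι ι ℤ} {d : ι → ℝ} {v : ι → ℤ} {s : (ι → ℤ) ≃ₗ[ℤ] (ι → ℤ)}

theorem toReal_eq (hs : IsReflectionIn A d v s) (x : ι → ℤ) :
    toReal (s x) = toReal x - (2 * form A d x v / form A d v v) • toReal v := by
  funext i
  simpa using hs.2 x i

theorem unique {t : (ι → ℤ) ≃ₗ[ℤ] (ι → ℤ)} (hs : IsReflectionIn A d v s)
    (ht : IsReflectionIn A d v t) : s = t :=
  LinearEquiv.ext fun x => toReal_injective (by rw [hs.toReal_eq, ht.toReal_eq])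

theorem form_map (hA : IsHyperbolic A d) (hs : IsReflectionIn A d v s) (x y : ι → ℤ) :
    form A d (s x) (s y) = form A d x y := by
  have hv := hs.1.ne'
  rw [form_eq_realForm, hs.toReal_eq, hs.toReal_eq]
  simp only [map_sub, map_smul, LinearMap.sub_apply, LinearMap.smul_apply, smul_eq_mul,
    ← form_eq_realForm]
  rw [hA.form_comm v y]
  field_simp
  ring

theorem conj {g : (ι → ℤ) ≃ₗ[ℤ] (ι → ℤ)} (hs : IsReflectionIn A d v s)
    (hg : ∀ x y, form A d (g x) (g y) = form A d x y) :
    IsReflectionIn A d (g v) (g * s * g⁻¹) := by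
  refine ⟨by rw [hg]; exact hs.1, fun x i => ?_⟩
  set y := g⁻¹ x with hy
  have hx : x = g y := by
    rw [hy, ← LinearEquiv.mul_apply, mul_inv_cancel]
    rfl
  have hsy : toReal (s y - y) = (-(2 * form A d y v / form A d v v)) • toReal v := by
    rw [map_sub, hs.toReal_eq]
    module
  have h := congrFun (toReal_map_of_smul g.toLinearMap hsy) i
  rw [LinearEquiv.mul_apply, LinearEquiv.mul_apply, ← hy, hx, hg, hg]
  simp only [LinearEquiv.coe_coe, map_sub, Pi.sub_apply, toReal_apply, Int.cast_sub, Pi.smul_apply,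
    smul_eq_mul] at h
  linarith

theorem apply_eq {m : ℤ} (hs : IsReflectionIn A d v s) {x : ι → ℤ}
    (hm : 2 * form A d x v = m * form A d v v) : s x = x - m • v := by
  apply toReal_injective
  rw [hs.toReal_eq, hm, mul_div_cancel_right₀ _ hs.1.ne', map_sub, toReal_zsmul]

theorem apply_self (hs : IsReflectionIn A d v s) : s v = -v := by
  rw [hs.apply_eq (m := 2) (by norm_num)]
  funext i
  simp
  ring

theorem apply_apply (hA : IsHyperbolic A d) (hs : IsReflectionIn A d v s) (x : ι → ℤ) :
    s (s x) = x := by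
  apply toReal_injective
  have h : form A d (s x) v = -form A d x v := by
    have := hs.form_map hA x v
    rw [hs.apply_self, form_neg_right] at this
    linarith
  rw [hs.toReal_eq, hs.toReal_eq, h]
  module

theorem inv_eq (hA : IsHyperbolic A d) (hs : IsReflectionIn A d v s) : s⁻¹ = s := by
  rw [inv_eq_iff_mul_eq_one]
  exact LinearEquiv.ext fun x => hs.apply_apply hA x

end IsReflectionIn

theorem realRoots_map {A : Matrix ι ι ℤ} {g : (ι → ℤ) ≃ₗ[ℤ] (ι → ℤ)} (hg : g ∈ weylGroup A)
    {x : ι → ℤ} (hx : x ∈ realRoots A) : g x ∈ realRoots A := by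
  obtain ⟨w, hw, i, rfl⟩ := hx
  exact ⟨g * w, mul_mem hg hw, i, rfl⟩

theorem simpleRoot_mem_realRoots (A : Matrix ι ι ℤ) (i : ι) : simpleRoot i ∈ realRoots A :=
  ⟨1, one_mem _, i, rfl⟩

/-- Serves to exclude the ratios 2 and 1/2 between proportional real roots. -/
theorem ne_two_zsmul_of_mem_realRoots {A : Matrix ι ι ℤ} {x : ι → ℤ} (hx : x ∈ realRoots A)
    (y : ι → ℤ) : x ≠ (2 : ℤ) • y := by
  rintro rfl
  obtain ⟨w, -, i, hi⟩ := hx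
  have h := congrArg (fun z => w.symm z i) hi
  simp only [map_smul, Pi.smul_apply, LinearEquiv.symm_apply_apply, simpleRoot,
    Pi.single_eq_same, smul_eq_mul] at h
  omega

/-- The simple reflection `s_i`. -/
def simpleReflection {A : Matrix ι ι ℤ} (hA : IsGCM A) (i : ι) : (ι → ℤ) ≃ₗ[ℤ] (ι → ℤ) :=
  LinearEquiv.ofInvolutive
    { toFun := fun x => x - (∑ j, A i j * x j) • simpleRoot i
      map_add' := fun x y => by
        simp only [Pi.add_apply, mul_add, Finset.sum_add_distrib]
        module
      map_smul' := fun c x => by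
        simp only [Pi.smul_apply, smul_eq_mul, mul_left_comm _ c, ← Finset.mul_sum,
          RingHom.id_apply]
        module }
    fun x => by
      have h : ∑ j, A i j * simpleRoot i j = 2 := by simp [simpleRoot, Pi.single_apply, hA.diag i]
      simp only [LinearMap.coe_mk, AddHom.coe_mk, Pi.sub_apply, Pi.smul_apply, smul_eq_mul,
        mul_sub, Finset.sum_sub_distrib, mul_left_comm _ (∑ j, A i j * x j), ← Finset.mul_sum, h]
      module

theorem simpleReflection_mem_weylGroup {A : Matrix ι ι ℤ} (hA : IsGCM A) (i : ι) :
    simpleReflection hA i ∈ weylGroup A :=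
  Subgroup.subset_closure ⟨i, fun _ => rfl⟩

namespace IsHyperbolic

variable {A : Matrix ι ι ℤ} {d : ι → ℝ}

theorem isReflectionIn_simpleRoot (hA : IsHyperbolic A d) {i : ι}
    {w : (ι → ℤ) ≃ₗ[ℤ] (ι → ℤ)} (hw : ∀ x, w x = x - (∑ j, A i j * x j) • simpleRoot i) :
    IsReflectionIn A d (simpleRoot i) w := by
  refine ⟨hA.form_simpleRoot_self_pos i, fun x k => ?_⟩
  rw [hw, hA.form_comm, form_simpleRoot_left, hA.form_simpleRoot_self]
  have := (hA.symmetrizer.pos i).ne'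
  simp only [Pi.sub_apply, Pi.smul_apply, smul_eq_mul, Int.cast_sub, Int.cast_mul]
  field_simp

theorem form_map_of_mem_weylGroup (hA : IsHyperbolic A d) {g : (ι → ℤ) ≃ₗ[ℤ] (ι → ℤ)}
    (hg : g ∈ weylGroup A) : ∀ x y, form A d (g x) (g y) = form A d x y := by
  induction hg using Subgroup.closure_induction with
  | mem w hw =>
    obtain ⟨i, hi⟩ := hw
    exact (hA.isReflectionIn_simpleRoot hi).form_map hA
  | one => exact fun _ _ => rfl
  | mul g h _ _ ihg ihh =>
    intro x y
    rw [LinearEquiv.mul_apply, LinearEquiv.mul_apply, ihg, ihh]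
  | inv g _ ih =>
    intro x y
    rw [← ih, ← LinearEquiv.mul_apply, ← LinearEquiv.mul_apply, mul_inv_cancel]
    rfl

theorem exists_form_eq_of_mem_realRoots (hA : IsHyperbolic A d) {v : ι → ℤ}
    (hv : v ∈ realRoots A) : ∃ i, form A d v v = 2 * d i := by
  obtain ⟨w, hw, i, rfl⟩ := hv
  exact ⟨i, by rw [hA.form_map_of_mem_weylGroup hw, hA.form_simpleRoot_self]⟩

theorem form_pos_of_mem_realRoots (hA : IsHyperbolic A d) {v : ι → ℤ}
    (hv : v ∈ realRoots A) : 0 < form A d v v := by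
  obtain ⟨i, hi⟩ := hA.exists_form_eq_of_mem_realRoots hv
  rw [hi]
  linarith [hA.symmetrizer.pos i]

theorem ne_zero_of_mem_realRoots (hA : IsHyperbolic A d) {v : ι → ℤ}
    (hv : v ∈ realRoots A) : v ≠ 0 := by
  rintro rfl
  have := hA.form_pos_of_mem_realRoots hv
  simp [form_eq_realForm] at this

theorem exists_reflection (hA : IsHyperbolic A d) {v : ι → ℤ} (hv : v ∈ realRoots A) :
    ∃ s ∈ weylGroup A, IsReflectionIn A d v s := by
  obtain ⟨w, hw, i, rfl⟩ := hv
  exact ⟨w * simpleReflection hA.gcm i * w⁻¹,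
    mul_mem (mul_mem hw (simpleReflection_mem_weylGroup hA.gcm i)) (inv_mem hw),
    (hA.isReflectionIn_simpleRoot fun _ => rfl).conj (hA.form_map_of_mem_weylGroup hw)⟩

theorem reflection_mem_weylGroup (hA : IsHyperbolic A d) {v : ι → ℤ} (hv : v ∈ realRoots A)
    {s : (ι → ℤ) ≃ₗ[ℤ] (ι → ℤ)} (hs : IsReflectionIn A d v s) : s ∈ weylGroup A := by
  obtain ⟨t, ht, htv⟩ := hA.exists_reflection hv
  rwa [hs.unique htv]

theorem neg_mem_realRoots (hA : IsHyperbolic A d) {v : ι → ℤ} (hv : v ∈ realRoots A) :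
    -v ∈ realRoots A := by
  obtain ⟨s, hs, hsv⟩ := hA.exists_reflection hv
  rw [← hsv.apply_self]
  exact realRoots_map hs hv

/-- The pairing of a lattice vector with a real coroot is an integer. -/
theorem exists_pairing (hA : IsHyperbolic A d) {v : ι → ℤ} (hv : v ∈ realRoots A) (x : ι → ℤ) :
    ∃ m : ℤ, 2 * form A d x v = m * form A d v v := by
  obtain ⟨w, hw, i, rfl⟩ := hv
  refine ⟨∑ j, A i j * w⁻¹ x j, ?_⟩
  have hx : form A d x (w (simpleRoot i)) = form A d (w⁻¹ x) (simpleRoot i) := by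
    rw [← hA.form_map_of_mem_weylGroup hw (w⁻¹ x), ← LinearEquiv.mul_apply, mul_inv_cancel]
    rfl
  rw [hx, hA.form_map_of_mem_weylGroup hw, hA.form_comm, form_simpleRoot_left,
    hA.form_simpleRoot_self]
  ring

theorem sub_zsmul_mem_realRoots (hA : IsHyperbolic A d) {v x : ι → ℤ} (hv : v ∈ realRoots A)
    (hx : x ∈ realRoots A) {m : ℤ} (hm : 2 * form A d x v = m * form A d v v) :
    x - m • v ∈ realRoots A := by
  obtain ⟨s, hs, hsv⟩ := hA.exists_reflection hv
  rw [← hsv.apply_eq hm]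
  exact realRoots_map hs hx

/-- The only real roots that the reflection in the real root `v` negates are `±v`. -/
theorem eq_or_eq_neg_of_reflection (hA : IsHyperbolic A d) {u v : ι → ℤ} (hu : u ∈ realRoots A)
    (hv : v ∈ realRoots A) {s : (ι → ℤ) ≃ₗ[ℤ] (ι → ℤ)} (hs : IsReflectionIn A d v s)
    (hsu : s u = -u) : u = v ∨ u = -v := by
  obtain ⟨m, hm⟩ := hA.exists_pairing hv u
  obtain ⟨n, hn⟩ := hA.exists_pairing hu v
  have huv : (2 : ℤ) • u = m • v := by
    rw [hs.apply_eq hm] at hsu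
    have : m • v = u - -u := by rw [← hsu]; abel
    rw [this]
    module
  have hu0 := (hA.form_pos_of_mem_realRoots hu).ne'
  -- Cartan integers of proportional roots multiply to 4, so m is ±1, ±2 or ±4; only ±2 does not
  -- make one root twice another.
  have hmn : m * n = 4 := by
    have h := congrArg (fun z => form A d z u) huv
    simp only [form_zsmul_left] at h
    have h4 : ((m * n : ℤ) : ℝ) * form A d u u = ((4 : ℤ) : ℝ) * form A d u u := by
      push_cast at h ⊢
      linear_combination (-m : ℝ) * hn - 2 * h
    exact_mod_cast mul_right_cancel₀ hu0 h4
  have hm4 : m ∣ 4 := ⟨n, hmn.symm⟩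
  have hle := Int.le_of_dvd (by norm_num) hm4
  have hge := Int.le_of_dvd (by norm_num) ((neg_dvd).2 hm4)
  have hpt : ∀ i, 2 * u i = m * v i := fun i => by simpa using congrFun huv i
  have hcase : m = 1 ∨ m = -1 ∨ m = 2 ∨ m = -2 ∨ m = 4 ∨ m = -4 := by
    have : -4 ≤ m := by omega
    interval_cases m <;> omega
  rcases hcase with rfl | rfl | rfl | rfl | rfl | rfl
  · exact (ne_two_zsmul_of_mem_realRoots hv u (funext fun i => by
      have := hpt i; simp; omega)).elim
  · exact (ne_two_zsmul_of_mem_realRoots hv (-u) (funext fun i => by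
      have := hpt i; simp; omega)).elim
  · exact Or.inl (funext fun i => by have := hpt i; omega)
  · exact Or.inr (funext fun i => by have := hpt i; simp; omega)
  · exact (ne_two_zsmul_of_mem_realRoots hu v (funext fun i => by
      have := hpt i; simp; omega)).elim
  · exact (ne_two_zsmul_of_mem_realRoots hu (-v) (funext fun i => by
      have := hpt i; simp; omega)).elim

end IsHyperbolic

/-! ### Finiteness of the set of mirrors between two points of hyperbolic space -/

namespace IsHyperbolic

variable {A : Matrix ι ι ℤ} {d : ι → ℝ}

/-- The majorant of the Lorentzian form associated with a vector of negative square. -/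
theorem majorant_pos (hA : IsHyperbolic A d) {x u : ι → ℝ} (hx : realForm A d x x < 0)
    (hu : u ≠ 0) :
    0 < realForm A d u u + 2 / (-realForm A d x x) * realForm A d u x ^ 2 := by
  set e := realForm A d x x with he
  set t := realForm A d u x / e with ht
  have hte : realForm A d u x = t * e := by rw [ht, div_mul_cancel₀ _ hx.ne]
  -- The majorant reverses the sign of the form along x: it is the square of the component
  -- orthogonal to x, minus t² times the negative square of x.
  have horth : realForm A d (u - t • x) x = 0 := by
    rw [map_sub, map_smul, LinearMap.sub_apply, LinearMap.smul_apply, smul_eq_mul, hte, ← he,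
      sub_self]
  have hsq : realForm A d (u - t • x) (u - t • x) = realForm A d u u - t ^ 2 * e := by
    rw [hA.realForm_sub_self]
    simp only [map_smul, LinearMap.smul_apply, smul_eq_mul, ← he, hte]
    ring
  have hval : realForm A d u u + 2 / (-e) * realForm A d u x ^ 2 =
      realForm A d (u - t • x) (u - t • x) - t ^ 2 * e := by
    rw [hsq, hte]
    have := hx.ne
    field_simp
    ring
  rw [hval]
  by_cases h0 : u - t • x = 0
  · have ht0 : t ≠ 0 := by
      rintro h
      rw [h, zero_smul, sub_zero] at h0
      exact hu h0
    have : 0 < t ^ 2 := by positivity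
    rw [h0, map_zero]
    nlinarith
  · have := hA.realForm_pos_of_orthogonal hx horth h0
    nlinarith [sq_nonneg t]

/-- By homogeneity, ε can be the minimum of the majorant on the compact unit sphere. -/
theorem exists_norm_sq_le (hA : IsHyperbolic A d) {x : ι → ℝ} (hx : realForm A d x x < 0) :
    ∃ ε > 0, ∀ u, ε * ‖u‖ ^ 2 ≤
      realForm A d u u + 2 / (-realForm A d x x) * realForm A d u x ^ 2 := by
  set Q : (ι → ℝ) → ℝ := fun u =>
    realForm A d u u + 2 / (-realForm A d x x) * realForm A d u x ^ 2 with hQ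
  have hcont : Continuous Q := by
    simp only [hQ, realForm_apply]
    fun_prop
  have hhom : ∀ (c : ℝ) u, Q (c • u) = c ^ 2 * Q u := fun c u => by
    simp only [hQ, map_smul, LinearMap.smul_apply, smul_eq_mul]
    ring
  have hx0 : x ≠ 0 := by
    rintro rfl
    simp at hx
  have hne : (Metric.sphere (0 : ι → ℝ) 1).Nonempty :=
    ⟨‖x‖⁻¹ • x, by simp [norm_smul, hx0]⟩
  obtain ⟨u₀, hu₀, hmin⟩ :=
    (isCompact_sphere (0 : ι → ℝ) 1).exists_isMinOn hne hcont.continuousOn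
  have hu₀0 : u₀ ≠ 0 := by
    rintro rfl
    simp at hu₀
  refine ⟨Q u₀, hA.majorant_pos hx hu₀0, fun u => ?_⟩
  change Q u₀ * ‖u‖ ^ 2 ≤ Q u
  rcases eq_or_ne u 0 with rfl | hu
  · simp [hQ]
  · have hn : ‖u‖ ≠ 0 := norm_ne_zero_iff.2 hu
    have h := hmin (show ‖u‖⁻¹ • u ∈ Metric.sphere (0 : ι → ℝ) 1 by simp [norm_smul, hu])
    have h : Q u₀ ≤ Q (‖u‖⁻¹ • u) := h
    rw [hhom] at h
    calc Q u₀ * ‖u‖ ^ 2 ≤ ‖u‖⁻¹ ^ 2 * Q u * ‖u‖ ^ 2 := by gcongr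
      _ = Q u := by field_simp

theorem finite_of_bounded (hA : IsHyperbolic A d) {x : ι → ℝ} (hx : realForm A d x x < 0) (C : ℝ) :
    {α : ι → ℤ | form A d α α ≤ C ∧ realForm A d (toReal α) x ^ 2 ≤ C}.Finite := by
  obtain ⟨ε, hε, hle⟩ := hA.exists_norm_sq_le hx
  set K := 2 / (-realForm A d x x) with hK
  have hK0 : 0 < K := div_pos two_pos (by linarith)
  obtain ⟨N, hN⟩ := exists_nat_ge ((C + K * C) / ε)
  refine (Set.finite_Icc (fun _ => -(N : ℤ) : ι → ℤ) (fun _ => (N : ℤ))).subset ?_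
  rintro α ⟨h1, h2⟩
  have hα : ∀ i, |α i| ≤ N := fun i => by
    have h3 := hle (toReal α)
    have h4 : |(α i : ℝ)| ≤ ‖toReal α‖ := by
      simpa using norm_le_pi_norm (toReal α) i
    have h5 : (α i : ℝ) ^ 2 ≤ N := by
      rw [← sq_abs]
      refine le_trans ?_ hN
      rw [le_div_iff₀ hε]
      rw [← form_eq_realForm] at h3
      have h6 : |(α i : ℝ)| ^ 2 ≤ ‖toReal α‖ ^ 2 := by gcongr
      nlinarith
    have h7 : (α i) ^ 2 ≤ N := by exact_mod_cast h5
    refine le_trans ?_ h7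
    rw [← sq_abs]
    rcases (abs_nonneg (α i)).eq_or_lt with h | h
    · simp [← h]
    · nlinarith
  exact ⟨fun i => (abs_le.1 (hα i)).1, fun i => (abs_le.1 (hα i)).2⟩

/-- The Cauchy–Schwarz inequality in the orthogonal complement of a vector of negative square. -/
theorem sq_realForm_le (hA : IsHyperbolic A d) {x u v : ι → ℝ} (hx : realForm A d x x < 0)
    (hu : realForm A d u x = 0) (hv : realForm A d v x = 0) :
    realForm A d u v ^ 2 ≤ realForm A d u u * realForm A d v v := by
  rcases eq_or_ne v 0 with rfl | hv0
  · simp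
  have hvv := hA.realForm_pos_of_orthogonal hx hv hv0
  have horth : realForm A d (realForm A d v v • u - realForm A d u v • v) x = 0 := by
    simp [hu, hv]
  have h : 0 ≤ realForm A d (realForm A d v v • u - realForm A d u v • v)
      (realForm A d v v • u - realForm A d u v • v) := by
    rcases eq_or_ne (realForm A d v v • u - realForm A d u v • v) 0 with h0 | h0
    · simp [h0]
    · exact (hA.realForm_pos_of_orthogonal hx horth h0).le
  rw [hA.realForm_sub_self] at h
  simp only [map_smul, LinearMap.smul_apply, smul_eq_mul] at h
  by_contra! hlt
  nlinarith [mul_pos hvv (sub_pos.2 hlt)]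

/-- If the mirror of `u` separates `x` from `y`, then the distance of `x` from it is bounded. -/
theorem sq_realForm_le_of_separates (hA : IsHyperbolic A d) {x y u : ι → ℝ} {e E : ℝ} (he : 0 < e)
    (hx : realForm A d x x = -e) (hy : realForm A d y y = -e) (hE : 0 ≤ E)
    (hxy : realForm A d y x = -E) (hux : 0 ≤ realForm A d u x) (huy : realForm A d u y ≤ 0) :
    realForm A d u x ^ 2 ≤ realForm A d u u * (E ^ 2 / e - e) := by
  set a := realForm A d u x with ha
  have h1 : realForm A d (u + (a / e) • x) x = 0 := by
    simp only [map_add, map_smul, LinearMap.add_apply, LinearMap.smul_apply, smul_eq_mul, hx, ← ha]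
    field_simp
    ring
  have h2 : realForm A d (y - (E / e) • x) x = 0 := by
    simp only [map_sub, map_smul, LinearMap.sub_apply, LinearMap.smul_apply, smul_eq_mul, hx, hxy]
    field_simp
    ring
  have hcs := hA.sq_realForm_le (by rw [hx]; linarith) h1 h2
  have h3 : realForm A d (u + (a / e) • x) (u + (a / e) • x) = realForm A d u u + a ^ 2 / e := by
    rw [hA.realForm_add_self]
    simp only [map_smul, LinearMap.smul_apply, smul_eq_mul, hx, ← ha]
    field_simp
    ring
  have h4 : realForm A d (y - (E / e) • x) (y - (E / e) • x) = E ^ 2 / e - e := by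
    rw [hA.realForm_sub_self]
    simp only [map_smul, LinearMap.smul_apply, smul_eq_mul, hx, hy, hxy]
    field_simp
    ring
  have h5 : realForm A d (u + (a / e) • x) (y - (E / e) • x) =
      realForm A d u y - E / e * a := by
    rw [map_add, LinearMap.add_apply, map_smul, LinearMap.smul_apply, hA.realForm_comm x, h2,
      map_sub, map_smul, ← ha]
    simp
  rw [h3, h4, h5] at hcs
  -- Separation makes (u | y) and -Ea/e both nonpositive. The square of Ea/e then cancels from the
  -- two sides of Cauchy–Schwarz.
  have h6 : (E / e * a) ^ 2 ≤ (realForm A d u y - E / e * a) ^ 2 := by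
    have : 0 ≤ E / e * a := by positivity
    nlinarith
  have h7 : (realForm A d u u + a ^ 2 / e) * (E ^ 2 / e - e) =
      realForm A d u u * (E ^ 2 / e - e) + (E / e * a) ^ 2 - a ^ 2 := by
    field_simp
    ring
  linarith

/-- With y the mirror image of x in r, the root α separates x from y. Real roots have bounded
square, so `sq_realForm_le_of_separates` bounds (α | x) and only finitely many lattice vectors
remain. -/
theorem finite_separating (hA : IsHyperbolic A d) {x : ι → ℝ} (hx : realForm A d x x < 0)
    {r : ι → ℤ} {s : (ι → ℤ) ≃ₗ[ℤ] (ι → ℤ)} (hs : IsReflectionIn A d r s) :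
    {α | α ∈ realRoots A ∧ 0 ≤ realForm A d (toReal α) x ∧
      realForm A d (toReal (s α)) x ≤ 0}.Finite := by
  have hr := hs.1
  set ρ := realForm A d (toReal r) x with hρ
  set n := form A d r r with hn
  set e := -realForm A d x x with he
  have he0 : 0 < e := by linarith
  set y := x - (2 * ρ / n) • toReal r with hy
  set E := e + 2 * ρ ^ 2 / n with hE
  have hE0 : 0 ≤ E := by positivity
  have hrr : realForm A d (toReal r) (toReal r) = n := (form_eq_realForm A d r r).symm
  have hyy : realForm A d y y = -e := by
    rw [hy, hA.realForm_sub_self]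
    simp only [map_smul, LinearMap.smul_apply, smul_eq_mul, hrr, hA.realForm_comm x, ← hρ]
    rw [he, neg_neg]
    field_simp
    ring
  have hyx : realForm A d y x = -E := by
    simp only [hy, map_sub, map_smul, LinearMap.sub_apply, LinearMap.smul_apply, smul_eq_mul, ← hρ]
    rw [hE, he]
    field_simp
    ring
  set D := ∑ i, 2 * d i with hD
  have hEe : 0 ≤ E ^ 2 / e - e := by
    rw [sub_nonneg, le_div_iff₀ he0]
    have : e ≤ E := by
      have : 0 ≤ 2 * ρ ^ 2 / n := by positivity
      linarith
    nlinarith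
  refine (hA.finite_of_bounded hx (max D (D * (E ^ 2 / e - e)))).subset ?_
  rintro α ⟨hα, h1, h2⟩
  have hαD : form A d α α ≤ D := by
    obtain ⟨i, hi⟩ := hA.exists_form_eq_of_mem_realRoots hα
    rw [hi, hD]
    exact Finset.single_le_sum (f := fun i => 2 * d i)
      (fun j _ => by linarith [hA.symmetrizer.pos j]) (Finset.mem_univ i)
  refine ⟨hαD.trans (le_max_left _ _), le_trans ?_ (le_max_right _ _)⟩
  have hαy : realForm A d (toReal α) y = realForm A d (toReal (s α)) x := by
    rw [hs.toReal_eq, hy]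
    simp only [map_sub, map_smul, LinearMap.sub_apply, LinearMap.smul_apply, smul_eq_mul,
      ← form_eq_realForm, ← hρ, ← hn]
    ring
  refine (hA.sq_realForm_le_of_separates he0 (by rw [he, neg_neg]) hyy hE0 hyx h1
    (hαy.trans_le h2)).trans ?_
  rw [← form_eq_realForm]
  gcongr

/-- There is a choice of a half of the root lattice such that every reflection in a real root
changes the sign of only finitely many real roots. -/
theorem exists_positive_system (hA : IsHyperbolic A d) :
    ∃ P : (ι → ℤ) → Prop, (∀ α, α ≠ 0 → (P (-α) ↔ ¬ P α)) ∧
      ∀ r s, IsReflectionIn A d r s → {α | α ∈ realRoots A ∧ P α ∧ ¬ P (s α)}.Finite := by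
  obtain ⟨x, hx⟩ := hA.exists_realForm_neg
  obtain ⟨f, hf⟩ := exists_injective_nat (ι → ℤ)
  -- Some roots may be orthogonal to x; for these an injective enumeration of the lattice chooses
  -- between α and -α.
  refine ⟨fun α => 0 < realForm A d (toReal α) x ∨
    (realForm A d (toReal α) x = 0 ∧ f α < f (-α)), fun α hα => ?_, fun r s hs => ?_⟩
  · have hne : f α ≠ f (-α) := fun h => by
      have h2 := hf h
      refine hα (funext fun i => ?_)
      have := congrFun h2 i
      rw [Pi.neg_apply] at this
      rw [Pi.zero_apply]
      omega
    beta_reduce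
    rw [map_neg, map_neg, LinearMap.neg_apply, neg_neg]
    rcases lt_trichotomy (realForm A d (toReal α) x) 0 with h | h | h
    · simp [h, h.ne, h.le]
    · simp only [h, neg_zero, lt_irrefl, false_or, true_and, not_lt]
      exact ⟨le_of_lt, fun h => lt_of_le_of_ne h hne.symm⟩
    · simp [h, h.ne', h.le]
  · refine (hA.finite_separating hx hs).subset ?_
    rintro α ⟨hα, h1, h2⟩
    refine ⟨hα, ?_, ?_⟩
    · rcases h1 with h1 | h1
      · exact h1.le
      · exact h1.1.ge
    · by_contra! h
      exact h2 (Or.inl h)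

end IsHyperbolic

/-! ### The sign character of a reflection group on a stable set of roots -/

section SignCharacter

variable {P : (ι → ℤ) → Prop} {X : Set (ι → ℤ)}

open Classical in
/-- The sign of a lattice vector with respect to a choice `P` of positive vectors. -/
noncomputable def signOf (P : (ι → ℤ) → Prop) (α : ι → ℤ) : ℤ := if P α then 1 else -1

open Classical in
/-- The positive one of the vectors `α` and `-α`. -/
noncomputable def absOf (P : (ι → ℤ) → Prop) (α : ι → ℤ) : ι → ℤ := if P α then α else -α

theorem signOf_mul_self (α : ι → ℤ) : signOf P α * signOf P α = 1 := by
  unfold signOf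
  split_ifs <;> rfl

theorem signOf_eq_one_iff {α : ι → ℤ} : signOf P α = 1 ↔ P α := by
  unfold signOf
  split_ifs with h <;> simp [h]

theorem absOf_of_pos {α : ι → ℤ} (h : P α) : absOf P α = α := if_pos h

theorem absOf_of_not_pos {α : ι → ℤ} (h : ¬ P α) : absOf P α = -α := if_neg h

theorem absOf_eq_or (α : ι → ℤ) : absOf P α = α ∨ absOf P α = -α := by
  unfold absOf
  split_ifs <;> simp

theorem absOf_mem (hX : ∀ α ∈ X, -α ∈ X) {α : ι → ℤ} (hα : α ∈ X) : absOf P α ∈ X := by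
  rcases absOf_eq_or (P := P) α with h | h <;> rw [h]
  · exact hα
  · exact hX α hα

theorem pos_absOf (hP : ∀ α, α ≠ 0 → (P (-α) ↔ ¬ P α)) {α : ι → ℤ} (hα : α ≠ 0) :
    P (absOf P α) := by
  unfold absOf
  split_ifs with h
  · exact h
  · exact (hP α hα).2 h

theorem signOf_neg (hP : ∀ α, α ≠ 0 → (P (-α) ↔ ¬ P α)) {α : ι → ℤ} (hα : α ≠ 0) :
    signOf P (-α) = -signOf P α := by
  have := hP α hα
  by_cases h : P α <;> simp_all [signOf]

theorem absOf_neg (hP : ∀ α, α ≠ 0 → (P (-α) ↔ ¬ P α)) {α : ι → ℤ} (hα : α ≠ 0) :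
    absOf P (-α) = absOf P α := by
  have := hP α hα
  by_cases h : P α <;> simp_all [absOf]

theorem absOf_map_absOf (hP : ∀ α, α ≠ 0 → (P (-α) ↔ ¬ P α))
    (g : (ι → ℤ) ≃ₗ[ℤ] (ι → ℤ)) {α : ι → ℤ} (hα : α ≠ 0) :
    absOf P (g (absOf P α)) = absOf P (g α) := by
  rcases absOf_eq_or (P := P) α with h | h <;> rw [h]
  rw [map_neg, absOf_neg hP (by simpa using hα)]

theorem signOf_map (hP : ∀ α, α ≠ 0 → (P (-α) ↔ ¬ P α))
    (g : (ι → ℤ) ≃ₗ[ℤ] (ι → ℤ)) {α : ι → ℤ} (hα : α ≠ 0) :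
    signOf P (g α) = signOf P α * signOf P (g (absOf P α)) := by
  by_cases h : P α
  · rw [absOf_of_pos h, signOf_eq_one_iff.2 h, one_mul]
  · rw [absOf_of_not_pos h, map_neg, signOf_neg hP (by simpa using hα),
      show signOf P α = -1 from if_neg h]
    ring

/-- The permutation of the positive elements of `X` induced by `g`. -/
noncomputable def posPerm (hP : ∀ α, α ≠ 0 → (P (-α) ↔ ¬ P α))
    (hX0 : ∀ α ∈ X, α ≠ 0) (hX : ∀ α ∈ X, -α ∈ X)
    (g : (ι → ℤ) ≃ₗ[ℤ] (ι → ℤ)) (hg : ∀ α, g α ∈ X ↔ α ∈ X) :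
    {α // α ∈ X ∧ P α} ≃ {α // α ∈ X ∧ P α} where
  toFun α := ⟨absOf P (g α), absOf_mem hX ((hg _).2 α.2.1),
    pos_absOf hP (hX0 _ ((hg _).2 α.2.1))⟩
  invFun α := ⟨absOf P (g.symm α), absOf_mem hX ((hg _).1 (by simpa using α.2.1)),
    pos_absOf hP (hX0 _ ((hg _).1 (by simpa using α.2.1)))⟩
  left_inv α := by
    ext1
    simp only [absOf_map_absOf hP g.symm (hX0 _ ((hg _).2 α.2.1)), LinearEquiv.symm_apply_apply,
      absOf_of_pos α.2.2]
  right_inv α := by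
    ext1
    have h : g.symm α ∈ X := (hg _).1 (by simpa using α.2.1)
    simp only [absOf_map_absOf hP g (hX0 _ h), LinearEquiv.apply_symm_apply,
      absOf_of_pos α.2.2]

/-- Multiplicativity of the sign character: the sign of sgα is the sign of gα times the sign of s
applied to the positive one of ±gα, and `posPerm` reindexes the second factor. -/
theorem hasFiniteMulSupport_mul_and_finprod (hP : ∀ α, α ≠ 0 → (P (-α) ↔ ¬ P α))
    (hX0 : ∀ α ∈ X, α ≠ 0) (hX : ∀ α ∈ X, -α ∈ X)
    {s g : (ι → ℤ) ≃ₗ[ℤ] (ι → ℤ)} (hg : ∀ α, g α ∈ X ↔ α ∈ X)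
    (hsf : Function.HasFiniteMulSupport fun α : {α // α ∈ X ∧ P α} => signOf P (s α))
    (hgf : Function.HasFiniteMulSupport fun α : {α // α ∈ X ∧ P α} => signOf P (g α)) :
    (Function.HasFiniteMulSupport fun α : {α // α ∈ X ∧ P α} => signOf P ((s * g) α)) ∧
    ∏ᶠ α : {α // α ∈ X ∧ P α}, signOf P ((s * g) α) =
      (∏ᶠ α : {α // α ∈ X ∧ P α}, signOf P (g α)) *
        ∏ᶠ α : {α // α ∈ X ∧ P α}, signOf P (s α) := by
  set e := posPerm hP hX0 hX g hg with he
  have hfun : (fun α : {α // α ∈ X ∧ P α} => signOf P ((s * g) α)) =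
      fun α : {α // α ∈ X ∧ P α} => signOf P (g α) * signOf P (s (e α)) := by
    funext α
    exact signOf_map hP s (hX0 _ ((hg _).2 α.2.1))
  have hsf' : Function.HasFiniteMulSupport fun α : {α // α ∈ X ∧ P α} => signOf P (s (e α)) :=
    Set.Finite.preimage e.injective.injOn hsf
  rw [hfun]
  refine ⟨hgf.mul hsf', ?_⟩
  rw [finprod_mul_distrib hgf hsf', finprod_comp_equiv e (f := fun α => signOf P (s α))]

/-- The sign changes of an involution cancel in pairs unless it negates an element. -/
theorem prod_signOf_involution (hP : ∀ α, α ≠ 0 → (P (-α) ↔ ¬ P α))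
    (hX0 : ∀ α ∈ X, α ≠ 0) (hX : ∀ α ∈ X, -α ∈ X)
    {s : (ι → ℤ) ≃ₗ[ℤ] (ι → ℤ)} (hs : ∀ α, s α ∈ X ↔ α ∈ X) (hss : ∀ α, s (s α) = α)
    (T : Finset {α // α ∈ X ∧ P α})
    (hT : ∀ α : {α // α ∈ X ∧ P α}, α ∈ T ↔ signOf P (s α) ≠ 1 ∧ s α ≠ -α) :
    ∏ α ∈ T, signOf P (s α) = 1 := by
  set e := posPerm hP hX0 hX s hs with he
  have hsx : ∀ α : {α // α ∈ X ∧ P α}, s α ≠ 0 := fun α => hX0 _ ((hs _).2 α.2.1)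
  have hee : ∀ α, e (e α) = α := fun α => by
    ext1
    change absOf P (s (absOf P (s α))) = α
    rw [absOf_map_absOf hP s (hsx α), hss, absOf_of_pos α.2.2]
  have hsign : ∀ α, signOf P (s (e α)) = signOf P (s α) := fun α => by
    have h := signOf_map hP s (hsx α)
    rw [hss, signOf_eq_one_iff.2 α.2.2] at h
    change signOf P (s (absOf P (s α))) = _
    have h2 := signOf_mul_self (P := P) (s α)
    calc _ = signOf P (s α) * signOf P (s α) * signOf P (s (absOf P (s α))) := by
          rw [h2, one_mul]
      _ = _ := by rw [mul_assoc, ← h, mul_one]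
  have hval : ∀ α : {α // α ∈ X ∧ P α}, signOf P (s α) ≠ 1 → ((e α : _) : ι → ℤ) = -s α :=
    fun α h => absOf_of_not_pos fun h' => h (signOf_eq_one_iff.2 h')
  refine Finset.prod_involution (fun α _ => e α) (fun α _ => ?_) (fun α hα h heq => ?_)
    (fun α hα => ?_) fun α _ => hee α
  · rw [hsign, signOf_mul_self]
  · have h1 := hval α h
    rw [heq] at h1
    exact ((hT α).1 hα).2 (neg_eq_iff_eq_neg.1 h1.symm)
  · have h := (hT α).1 hα
    refine (hT _).2 ⟨(hsign α).symm ▸ h.1, fun h2 => h.2 ?_⟩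
    rw [hval α h.1, map_neg, hss, neg_neg] at h2
    exact h2.symm

end SignCharacter

namespace IsHyperbolic

variable {A : Matrix ι ι ℤ} {d : ι → ℝ}

/-- If a set `R` of real roots is stable under its reflections, then the only reflections in real
roots in the group they generate are those in the elements of `R`. -/
theorem mem_of_reflection_mem (hA : IsHyperbolic A d) {R : Set (ι → ℤ)} (hR : R ⊆ realRoots A)
    (hstab : ∀ r ∈ R, ∀ s, IsReflectionIn A d r s → ∀ t ∈ R, s t ∈ R) {v : ι → ℤ}
    (hv : v ∈ realRoots A) {s : (ι → ℤ) ≃ₗ[ℤ] (ι → ℤ)} (hs : IsReflectionIn A d v s)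
    (hmem : s ∈ reflectionGroup A d R) : v ∈ R := by
  classical
  by_contra hvR
  obtain ⟨P, hP, hfin⟩ := hA.exists_positive_system
  have hnegR : ∀ r ∈ R, -r ∈ R := fun r hr => by
    obtain ⟨t, -, ht⟩ := hA.exists_reflection (hR hr)
    rw [← ht.apply_self]
    exact hstab r hr t ht r hr
  -- The sign character is taken over the roots outside R, where a reflection in an element of R
  -- negates nothing.
  set X := realRoots A \ R with hXdef
  have hX0 : ∀ α ∈ X, α ≠ 0 := fun α hα => hA.ne_zero_of_mem_realRoots hα.1
  have hX : ∀ α ∈ X, -α ∈ X := fun α hα =>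
    ⟨hA.neg_mem_realRoots hα.1, fun h => hα.2 (by simpa using hnegR _ h)⟩
  have hsupp : ∀ r t, IsReflectionIn A d r t →
      Function.HasFiniteMulSupport fun α : {α // α ∈ X ∧ P α} => signOf P (t α) := by
    intro r t ht
    refine ((hfin r t ht).preimage Subtype.val_injective.injOn).subset fun α hα => ?_
    exact ⟨α.2.1.1, α.2.2, fun h => hα (signOf_eq_one_iff.2 h)⟩
  have hgen : ∀ r ∈ R, ∀ t, IsReflectionIn A d r t → (∀ α, t α ∈ X ↔ α ∈ X) ∧
      ∏ᶠ α : {α // α ∈ X ∧ P α}, signOf P (t α) = 1 := by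
    intro r hr t ht
    have htW := hA.reflection_mem_weylGroup (hR hr) ht
    have hfwd : ∀ α ∈ X, t α ∈ X := fun α hα =>
      ⟨realRoots_map htW hα.1, fun h => hα.2 (by
        rw [← ht.apply_apply hA α]
        exact hstab r hr t ht _ h)⟩
    have hiff : ∀ α, t α ∈ X ↔ α ∈ X := fun α =>
      ⟨fun h => by simpa [ht.apply_apply hA] using hfwd _ h, hfwd α⟩
    refine ⟨hiff, ?_⟩
    have hmemT : ∀ α, α ∈ (hsupp r t ht).toFinset ↔ signOf P (t α) ≠ 1 :=
      fun α => Set.Finite.mem_toFinset (hsupp r t ht)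
    rw [finprod_eq_prod _ (hsupp r t ht)]
    refine prod_signOf_involution hP hX0 hX hiff (ht.apply_apply hA) _ fun α => ?_
    rw [hmemT]
    refine ⟨fun h => ⟨h, fun hneg => ?_⟩, fun h => h.1⟩
    rcases hA.eq_or_eq_neg_of_reflection α.2.1.1 (hR hr) ht hneg with h' | h'
    · exact α.2.1.2 (h' ▸ hr)
    · exact α.2.1.2 (h' ▸ hnegR r hr)
  have hall : (∀ α, s α ∈ X ↔ α ∈ X) ∧
      (Function.HasFiniteMulSupport fun α : {α // α ∈ X ∧ P α} => signOf P (s α)) ∧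
      ∏ᶠ α : {α // α ∈ X ∧ P α}, signOf P (s α) = 1 := by
    clear hs
    unfold reflectionGroup at hmem
    have hstep : ∀ t ∈ {w | ∃ v ∈ R, IsReflectionIn A d v w}, ∀ g : (ι → ℤ) ≃ₗ[ℤ] (ι → ℤ),
        ((∀ α, g α ∈ X ↔ α ∈ X) ∧
        (Function.HasFiniteMulSupport fun α : {α // α ∈ X ∧ P α} => signOf P (g α)) ∧
        ∏ᶠ α : {α // α ∈ X ∧ P α}, signOf P (g α) = 1) → ((∀ α, (t * g) α ∈ X ↔ α ∈ X) ∧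
        (Function.HasFiniteMulSupport fun α : {α // α ∈ X ∧ P α} => signOf P ((t * g) α)) ∧
        ∏ᶠ α : {α // α ∈ X ∧ P α}, signOf P ((t * g) α) = 1) := by
      rintro t ⟨r, hr, ht⟩ g ⟨hg, hgf, hg1⟩
      obtain ⟨htX, ht1⟩ := hgen r hr t ht
      obtain ⟨h1, h2⟩ := hasFiniteMulSupport_mul_and_finprod hP hX0 hX hg (hsupp r t ht) hgf
      exact ⟨fun α => (htX _).trans (hg α), h1, by rw [h2, hg1, ht1, one_mul]⟩
    induction hmem using Subgroup.closure_induction_left with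
    | one =>
      have h1 : (fun α : {α // α ∈ X ∧ P α} =>
          signOf P ((1 : (ι → ℤ) ≃ₗ[ℤ] (ι → ℤ)) α)) = 1 :=
        funext fun α => signOf_eq_one_iff.2 α.2.2
      refine ⟨fun _ => Iff.rfl, ?_, ?_⟩
      · rw [h1]
        exact Function.hasFiniteMulSupport_fun_one
      · exact finprod_eq_one_of_forall_eq_one (congrFun h1)
    | mul_left t ht g _ ih => exact hstep t ht g ih
    | inv_mul_cancel t ht g _ ih =>
      obtain ⟨r, hr, htr⟩ := ht
      rw [htr.inv_eq hA]
      exact hstep t ⟨r, hr, htr⟩ g ih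
  obtain ⟨hsX, hsf, hs1⟩ := hall
  have hvX : v ∈ X := ⟨hv, hvR⟩
  -- The only positive element of X negated by s; removing it, the other sign changes pair off and
  -- the product is -1.
  set V : {α // α ∈ X ∧ P α} := ⟨absOf P v, absOf_mem hX hvX, pos_absOf hP (hX0 v hvX)⟩ with hV
  have hsV : s V = -(V : ι → ℤ) := by
    change s (absOf P v) = -absOf P v
    rcases absOf_eq_or (P := P) v with h | h <;> rw [h]
    · exact hs.apply_self
    · rw [map_neg, hs.apply_self]
  have hsignV : signOf P (s V) = -1 := by
    rw [hsV, signOf_neg hP (hX0 _ V.2.1), signOf_eq_one_iff.2 V.2.2]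
  have hmemT : ∀ α, α ∈ hsf.toFinset ↔ signOf P (s α) ≠ 1 :=
    fun α => Set.Finite.mem_toFinset hsf
  have hVmem : V ∈ hsf.toFinset := by
    rw [hmemT, hsignV]
    norm_num
  rw [finprod_eq_prod _ hsf, ← Finset.mul_prod_erase _ _ hVmem, hsignV,
    prod_signOf_involution hP hX0 hX hsX (hs.apply_apply hA)] at hs1
  · norm_num at hs1
  · intro α
    rw [Finset.mem_erase, hmemT]
    refine ⟨fun h => ⟨h.2, fun hneg => h.1 (Subtype.ext ?_)⟩, fun h => ⟨?_, h.1⟩⟩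
    · change (α : ι → ℤ) = absOf P v
      rcases hA.eq_or_eq_neg_of_reflection α.2.1.1 hv hs hneg with h' | h'
      · rw [← h', absOf_of_pos α.2.2]
      · rw [← absOf_neg hP (hX0 v hvX), ← h', absOf_of_pos α.2.2]
    · rintro rfl
      exact h.2 hsV

end IsHyperbolic

/-! ### Root systems in a hyperbolic root system -/

namespace IsRootSystemIn

variable {A : Matrix ι ι ℤ} {d : ι → ℝ} {A₁ : Matrix κ κ ℤ} {d₁ : κ → ℝ}
  {φ : (κ → ℤ) →ₗ[ℤ] (ι → ℤ)}

theorem mem_realRoots (hA₁ : IsHyperbolic A₁ d₁) (hφ : IsRootSystemIn A d A₁ d₁ φ) {x : κ → ℤ}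
    (hx : x ∈ realRoots A₁) : φ x ∈ realRoots A := by
  refine (hφ.subset ⟨x, Or.inl hx, rfl⟩).resolve_right fun h => ?_
  obtain ⟨c, hc, hform⟩ := hφ.form_eq
  have := mul_pos hc (hA₁.form_pos_of_mem_realRoots hx)
  rw [← hform] at this
  exact this.not_ge h.2

theorem pairing_eq (hφ : IsRootSystemIn A d A₁ d₁ φ) {x y : κ → ℤ} {m : ℤ}
    (h : 2 * form A₁ d₁ x y = m * form A₁ d₁ y y) :
    2 * form A d (φ x) (φ y) = m * form A d (φ y) (φ y) := by
  obtain ⟨c, hc, hform⟩ := hφ.form_eq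
  rw [hform, hform]
  linear_combination c * h

/-- The reflection in `φ ρ` induces the reflection in `ρ` on the sublattice. -/
theorem reflection_map (hφ : IsRootSystemIn A d A₁ d₁ φ) {ρ x : κ → ℤ} {m : ℤ}
    (h : 2 * form A₁ d₁ x ρ = m * form A₁ d₁ ρ ρ) {s : (ι → ℤ) ≃ₗ[ℤ] (ι → ℤ)}
    (hs : IsReflectionIn A d (φ ρ) s) : s (φ x) = φ (x - m • ρ) := by
  rw [hs.apply_eq (hφ.pairing_eq h), map_sub, map_smul]

theorem reflection_map_mem (hA₁ : IsHyperbolic A₁ d₁)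
    (hφ : IsRootSystemIn A d A₁ d₁ φ) {s : (ι → ℤ) ≃ₗ[ℤ] (ι → ℤ)} {r : ι → ℤ}
    (hr : r ∈ φ '' realRoots A₁) (hs : IsReflectionIn A d r s) {t : ι → ℤ}
    (ht : t ∈ φ '' realRoots A₁) : s t ∈ φ '' realRoots A₁ := by
  obtain ⟨ρ, hρ, rfl⟩ := hr
  obtain ⟨x, hx, rfl⟩ := ht
  obtain ⟨m, hm⟩ := hA₁.exists_pairing hρ x
  exact ⟨_, hA₁.sub_zsmul_mem_realRoots hρ hx hm, (hφ.reflection_map hm hs).symm⟩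

/-- The Weyl group of `A₁` acts on the sublattice by elements of the Weyl group of `Δ₁`. -/
theorem exists_mem_subWeylGroup (hA : IsHyperbolic A d) (hA₁ : IsHyperbolic A₁ d₁)
    (hφ : IsRootSystemIn A d A₁ d₁ φ) {w : (κ → ℤ) ≃ₗ[ℤ] (κ → ℤ)} (hw : w ∈ weylGroup A₁) :
    ∃ g ∈ subWeylGroup A d φ, ∀ x, g (φ x) = φ (w x) := by
  induction hw using Subgroup.closure_induction with
  | mem w hw =>
    obtain ⟨j, hj⟩ := hw
    have hroot := simpleRoot_mem_realRoots A₁ j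
    obtain ⟨s, -, hs⟩ := hA.exists_reflection (hφ.mem_realRoots hA₁ hroot)
    refine ⟨s, Subgroup.subset_closure ⟨_, ⟨j, rfl⟩, hs⟩, fun x => ?_⟩
    obtain ⟨m, hm⟩ := hA₁.exists_pairing hroot x
    rw [hφ.reflection_map hm hs, (hA₁.isReflectionIn_simpleRoot hj).apply_eq hm]
  | one => exact ⟨1, one_mem _, fun _ => rfl⟩
  | mul w₁ w₂ _ _ ih₁ ih₂ =>
    obtain ⟨g₁, hg₁, h₁⟩ := ih₁
    obtain ⟨g₂, hg₂, h₂⟩ := ih₂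
    refine ⟨g₁ * g₂, mul_mem hg₁ hg₂, fun x => ?_⟩
    rw [LinearEquiv.mul_apply, h₂, h₁, LinearEquiv.mul_apply]
  | inv w _ ih =>
    obtain ⟨g, hg, h⟩ := ih
    refine ⟨g⁻¹, inv_mem hg, fun x => g.injective ?_⟩
    rw [h, ← LinearEquiv.mul_apply, ← LinearEquiv.mul_apply, mul_inv_cancel, mul_inv_cancel]
    rfl

/-- A root system `Δ₁` is the intersection of `Δ` with its lattice, if the lattice is proper and
the Weyl group of `Δ₁` is a maximal proper reflection subgroup. -/
theorem image_roots_eq (hA : IsHyperbolic A d) (hA₁ : IsHyperbolic A₁ d₁)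
    (hφ : IsRootSystemIn A d A₁ d₁ φ) (hmin : IsMinimalDecomposition A d φ)
    (hL : LinearMap.range φ < ⊤) :
    φ '' roots A₁ d₁ = roots A d ∩ (LinearMap.range φ : Set (ι → ℤ)) := by
  set R : Set (ι → ℤ) := realRoots A ∩ (LinearMap.range φ : Set (ι → ℤ)) with hR
  have hstab : ∀ r ∈ R, ∀ s, IsReflectionIn A d r s → ∀ t ∈ R, s t ∈ R := by
    rintro r hr s hs t ht
    refine ⟨realRoots_map (hA.reflection_mem_weylGroup hr.1 hs) ht.1, ?_⟩
    obtain ⟨m, hm⟩ := hA.exists_pairing hr.1 t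
    rw [hs.apply_eq hm]
    exact sub_mem ht.2 (Submodule.smul_mem _ _ hr.2)
  have hle : subWeylGroup A d φ ≤ reflectionGroup A d R := by
    refine Subgroup.closure_mono ?_
    rintro w ⟨_, ⟨j, rfl⟩, hw⟩
    exact ⟨_, ⟨hφ.mem_realRoots hA₁ (simpleRoot_mem_realRoots A₁ j), ⟨_, rfl⟩⟩, hw⟩
  have hleW : reflectionGroup A d R ≤ weylGroup A := by
    refine (Subgroup.closure_le _).2 ?_
    rintro w ⟨v, hv, hw⟩
    exact hA.reflection_mem_weylGroup hv.1 hw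
  have hne : reflectionGroup A d R ≠ weylGroup A := by
    intro heq
    refine hL.ne (eq_top_iff.2 fun x _ => ?_)
    have hsimple : ∀ i, simpleRoot i ∈ R := fun i =>
      hA.mem_of_reflection_mem Set.inter_subset_left hstab (simpleRoot_mem_realRoots A i)
        (hA.isReflectionIn_simpleRoot fun _ => rfl)
        (heq ▸ simpleReflection_mem_weylGroup hA.gcm i)
    have hx : x = ∑ i, x i • simpleRoot i := by
      funext j
      simp [simpleRoot, Finset.sum_apply, Pi.single_apply]
    rw [hx]
    exact sum_mem fun i _ => Submodule.smul_mem _ _ (hsimple i).2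
  have hWeq : reflectionGroup A d R = subWeylGroup A d φ :=
    hmin.2 _ ⟨{w | ∃ v ∈ R, IsReflectionIn A d v w}, fun w ⟨v, _, hw⟩ => ⟨v, hw⟩, rfl⟩ hle
      (lt_of_le_of_ne hleW hne)
  refine Set.Subset.antisymm (fun y hy => ⟨hφ.subset hy, ?_⟩) ?_
  · obtain ⟨x, -, rfl⟩ := hy
    exact ⟨x, rfl⟩
  · rintro y ⟨hy | hy, hyL⟩
    · obtain ⟨s, -, hs⟩ := hA.exists_reflection hy
      have hsR : s ∈ reflectionGroup A d R := Subgroup.subset_closure ⟨y, ⟨hy, hyL⟩, hs⟩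
      rw [hWeq] at hsR
      have hs₁ : s ∈ reflectionGroup A d (φ '' realRoots A₁) := by
        refine Subgroup.closure_mono ?_ hsR
        rintro w ⟨_, ⟨j, rfl⟩, hw⟩
        exact ⟨_, ⟨_, simpleRoot_mem_realRoots A₁ j, rfl⟩, hw⟩
      -- The same lemma, now for the real roots of Δ₁, whose reflection group contains W₁.
      have hmem := hA.mem_of_reflection_mem
        (by rintro _ ⟨x, hx, rfl⟩; exact hφ.mem_realRoots hA₁ hx)
        (fun r hr s hs t ht => hφ.reflection_map_mem hA₁ hr hs ht) hy hs hs₁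
      exact Set.image_mono Set.subset_union_left hmem
    · obtain ⟨x, rfl⟩ := hyL
      refine ⟨x, Or.inr ⟨?_, ?_⟩, rfl⟩
      · rintro rfl
        exact hy.1 (map_zero φ)
      · obtain ⟨c, hc, hform⟩ := hφ.form_eq
        have := hy.2
        rw [hform] at this
        exact nonpos_of_mul_nonpos_right this hc

/-- The real roots of `Δ` in the lattice of a closed `Δ₁` that are not in `Δ₁`. -/
theorem isDescentSet (hA : IsHyperbolic A d) (hA₁ : IsHyperbolic A₁ d₁)
    (hφ : IsRootSystemIn A d A₁ d₁ φ) (hclosed : ClosedIn (φ '' realRoots A₁) (realRoots A)) :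
    IsDescentSet A₁ d₁ (φ ⁻¹' realRoots A \ realRoots A₁) where
  neg_mem α hα := by
    refine ⟨?_, fun h => hα.2 (by simpa using hA₁.neg_mem_realRoots h)⟩
    rw [Set.mem_preimage, map_neg]
    exact hA.neg_mem_realRoots hα.1
  form_pos α hα := by
    obtain ⟨c, hc, hform⟩ := hφ.form_eq
    have h := hA.form_pos_of_mem_realRoots hα.1
    rw [hform] at h
    exact pos_of_mul_pos_right h hc.le
  simpleRoot_notMem i h := h.2 (simpleRoot_mem_realRoots A₁ i)
  reflection_mem α hα i := by
    have hroot := simpleRoot_mem_realRoots A₁ i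
    obtain ⟨m, hm⟩ := hA₁.exists_pairing hroot α
    refine ⟨m, hm, ?_, fun h => hα.2 ?_⟩
    · rw [Set.mem_preimage, map_sub, map_smul]
      exact hA.sub_zsmul_mem_realRoots (hφ.mem_realRoots hA₁ hroot) hα.1 (hφ.pairing_eq hm)
    · have h' := hA₁.sub_zsmul_mem_realRoots (m := -m) hroot h (by
        rw [form_sub_left, form_zsmul_left]
        push_cast
        linear_combination hm)
      simpa using h'
  sub_mem α hα i hpos := by
    have hroot := simpleRoot_mem_realRoots A₁ i
    have hroot' := hφ.mem_realRoots hA₁ hroot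
    obtain ⟨c, hc, hform⟩ := hφ.form_eq
    obtain ⟨m, hm⟩ := hA₁.exists_pairing hroot α
    obtain ⟨n, hn'⟩ := hA.exists_pairing hα.1 (φ (simpleRoot i))
    have hn : 2 * form A₁ d₁ α (simpleRoot i) = n * form A₁ d₁ α α := by
      rw [hform, hform, hA₁.form_comm _ α] at hn'
      exact mul_left_cancel₀ hc.ne' (by linear_combination hn')
    have hii := hA₁.form_simpleRoot_self_pos i
    have hαα : 0 < form A₁ d₁ α α := by
      have h := hA.form_pos_of_mem_realRoots hα.1
      rw [hform] at h
      exact pos_of_mul_pos_right h hc.le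
    have hm0 : 0 < m := by
      have h : (0 : ℝ) < m := by
        by_contra! h
        nlinarith
      exact_mod_cast h
    have hn0 : 0 < n := by
      have h : (0 : ℝ) < n := by
        by_contra! h
        nlinarith
      exact_mod_cast h
    -- If α - α_i were a real root of Δ₁, closedness would make α = (α - α_i) + α_i one as well.
    have hsub : φ (α - simpleRoot i) ∈ realRoots A → α - simpleRoot i ∈
        φ ⁻¹' realRoots A \ realRoots A₁ := fun h => by
      refine ⟨h, fun h' => hα.2 ?_⟩
      have hsum := hclosed _ ⟨_, h', rfl⟩ _ ⟨_, hroot, rfl⟩ (by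
        rw [← map_add, sub_add_cancel]
        exact hα.1)
      rw [← map_add, sub_add_cancel] at hsum
      obtain ⟨x, hx, hxα⟩ := hsum
      rwa [← hφ.injective hxα]
    -- If m = 1, then α - α_i is the reflection of α in α_i; if n = 1, it is minus the reflection of
    -- α_i in α. Otherwise m, n ≥ 2, which gives the two inequalities.
    by_cases hm1 : m = 1
    · refine Or.inl (hsub ?_)
      have := hA.sub_zsmul_mem_realRoots hroot' hα.1 (hφ.pairing_eq hm)
      rwa [hm1, one_smul, ← map_sub] at this
    by_cases hn1 : n = 1
    · refine Or.inl (hsub ?_)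
      have := hA.neg_mem_realRoots (hA.sub_zsmul_mem_realRoots hα.1 hroot' hn')
      rwa [hn1, one_smul, neg_sub, ← map_sub] at this
    · have hm2 : (2 : ℝ) ≤ m := by exact_mod_cast (by omega : 2 ≤ m)
      have hn2 : (2 : ℝ) ≤ n := by exact_mod_cast (by omega : 2 ≤ n)
      right
      constructor <;> nlinarith

/-- If the lattice of `Δ₁` is everything and the real roots of `Δ₁` are closed under addition in
those of `Δ`, then `Δ₁` has the same Weyl group as `Δ`. -/
theorem weylGroup_le (hA : IsHyperbolic A d) (hA₁ : IsHyperbolic A₁ d₁)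
    (hφ : IsRootSystemIn A d A₁ d₁ φ) (hclosed : ClosedIn (φ '' realRoots A₁) (realRoots A))
    (hL : LinearMap.range φ = ⊤) (hle : subWeylGroup A d φ ≤ weylGroup A) :
    weylGroup A ≤ subWeylGroup A d φ := by
  refine (Subgroup.closure_le _).2 ?_
  rintro w ⟨i, hi⟩
  obtain ⟨x, hx⟩ := LinearMap.range_eq_top.1 hL (simpleRoot i)
  have hxroot : x ∈ realRoots A₁ := by
    by_contra h
    have hmem : x ∈ φ ⁻¹' realRoots A \ realRoots A₁ :=
      ⟨by rw [Set.mem_preimage, hx]; exact simpleRoot_mem_realRoots A i, h⟩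
    rw [(hφ.isDescentSet hA hA₁ hclosed).eq_empty hA₁] at hmem
    exact hmem
  obtain ⟨w₁, hw₁, j, rfl⟩ := hxroot
  obtain ⟨g, hg, hgφ⟩ := hφ.exists_mem_subWeylGroup hA hA₁ hw₁
  obtain ⟨s, -, hs⟩ :=
    hA.exists_reflection (hφ.mem_realRoots hA₁ (simpleRoot_mem_realRoots A₁ j))
  -- The simple root α_i of Δ is g applied to a simple root of Δ₁ with g in W₁, so its reflection is
  -- a conjugate lying in W₁.
  have hconj := hs.conj (hA.form_map_of_mem_weylGroup (hle hg))
  rw [hgφ, hx] at hconj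
  rw [SetLike.mem_coe, (hA.isReflectionIn_simpleRoot hi).unique hconj]
  exact mul_mem (mul_mem hg (Subgroup.subset_closure ⟨_, ⟨j, rfl⟩, hs⟩)) (inv_mem hg)

end IsRootSystemIn

end HypRoot

/-! ### The equivalence of the four conditions -/

theorem lemma1 {ι κ : Type*} [Fintype ι] [DecidableEq ι] [Fintype κ] [DecidableEq κ]
    (A : Matrix ι ι ℤ) (d : ι → ℝ) (hA : HypRoot.IsHyperbolic A d)
    (A₁ : Matrix κ κ ℤ) (d₁ : κ → ℝ) (hA₁ : HypRoot.IsHyperbolic A₁ d₁)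
    (φ : (κ → ℤ) →ₗ[ℤ] (ι → ℤ)) (hφ : HypRoot.IsRootSystemIn A d A₁ d₁ φ)
    (hmin : HypRoot.IsMinimalDecomposition A d φ) :
    [ LinearMap.range φ < ⊤,
      φ '' HypRoot.roots A₁ d₁ = HypRoot.roots A d ∩ (LinearMap.range φ : Set (ι → ℤ)),
      HypRoot.ClosedIn (φ '' HypRoot.roots A₁ d₁) (HypRoot.roots A d),
      HypRoot.ClosedIn (φ '' HypRoot.realRoots A₁) (HypRoot.realRoots A) ].TFAE := by
  tfae_have 1 → 2 := hφ.image_roots_eq hA hA₁ hmin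
  tfae_have 2 → 3 := by
    intro h α hα β hβ hαβ
    rw [h] at hα hβ ⊢
    exact ⟨hαβ, add_mem hα.2 hβ.2⟩
  tfae_have 3 → 4 := by
    intro h α hα β hβ hαβ
    obtain ⟨x, hx | hx, hxαβ⟩ := h α (Set.image_mono Set.subset_union_left hα) β
      (Set.image_mono Set.subset_union_left hβ) (Or.inl hαβ)
    · exact ⟨x, hx, hxαβ⟩
    · obtain ⟨c, hc, hform⟩ := hφ.form_eq
      have hpos := hA.form_pos_of_mem_realRoots hαβ
      rw [← hxαβ, hform] at hpos
      exact absurd hx.2 (pos_of_mul_pos_right hpos hc.le).not_ge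
  tfae_have 4 → 1 := by
    intro h
    refine lt_top_iff_ne_top.2 fun hL => ?_
    exact hmin.1.not_ge (hφ.weylGroup_le hA hA₁ h hL hmin.1.le)
  tfae_finish
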